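/- **Model.** Let $G=(V,E,w)$ be an undirected weighted graph on $n$ nodes with identifiers $1,\dots,n$ and edge weights $w:E\to\{1,\dots,W\}$, where $W\le n^{q}$ for a constant $q$. In the hybrid network on $G$, time is divided into synchronous rounds, and messages have $O(\log n)$ bits. In every round each node may send any number of messages to each of its neighbors in $G$ (local edges), and at most $\gamma=\Theta(\log n)$ messages to arbitrary nodes of $V$ (global edges). If at most $\gamma$ global messages are sent to a node in a round, it receives all of them; otherwise an adversary selects an arbitrary subset of at most $\gamma$ of them to be delivered, and the others are dropped. All nodes run the same program; local computation is unrestricted, and every node has private random values, independent over nodes and rounds. Initially a node knows $n$, its identifier, whether it is the source, and its incident edges with their weights. **Definitions.** Let $d(u,v)$ be the least weight of a $u$-$v$-path in $G$, and $d_h(u,v)$ the least weight of a $u$-$v$-path with at most $h$ edges ($\infty$ if there is none). The shortest-path diameter $\mathsf{SPD}$ of $G$ is the least $h$ with $d_h(u,v)=d(u,v)$ for all $u,v\in V$. In the single-source shortest paths problem (SSSP) there is a source $s\in V$, and every node $u$ has to terminate with output $d(u,s)$. The nodes do not know $\mathsf{SPD}$. **Theorem.** Exact SSSP can be solved in $\tilde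 O(\sqrt{\mathsf{SPD}})$ rounds with high probability. Precisely: there is a constant $k$ such that for every $q$ there is a constant $\beta$ such that for all constants $\kappa\in\{1,2,\dots\}$ and $c>0$ there are constants $C,n_0$ and an algorithm in the above model, with messages of $\beta\lfloor\log_2 n\rfloor$ bits and $\gamma=\kappa\lfloor\log_2 n\rfloor$, for which the following holds. For all $n\ge n_0$, all $G$ as above with weights at most $n^q$ and all sources $s$, with probability at least $1-n^{-c}$, within $C\sqrt{\max(\mathsf{SPD},1)}\,(\log n)^{k}$ rounds every node $u$ has terminated with output $d(u,s)$, whatever the adversary does. ($\mathsf{SPD}\ge 1$ unless $G$ has no edges.) -/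

import Mathlib

/-! Exact shortest paths in weighted graphs, and the synchronous hybrid network model with
unbounded local communication and capacitated global communication. -/

namespace Hybrid

/-- An undirected graph on the nodes `Fin n` with positive integral edge weights. Only the values
of `weight` on edges matter. -/
structure WeightedGraph (n : ℕ) where
  graph : SimpleGraph (Fin n)
  weight : Sym2 (Fin n) → ℕ
  weight_pos : ∀ e ∈ graph.edgeSet, 1 ≤ weight e

namespace WeightedGraph

variable {n : ℕ} (G : WeightedGraph n)

/-- The length `w(P)` of a path: the sum of the weights of its edges. -/
def pathWeight {u v : Fin n} (p : G.graph.Path u v) : ℕ :=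
  (p.1.edges.map G.weight).sum

/-- The distance `d(u,v)`, the least weight of a `u`-`v`-path; it is `⊤` if there is no path. -/
noncomputable def dist (u v : Fin n) : ℕ∞ :=
  ⨅ p : G.graph.Path u v, (G.pathWeight p : ℕ∞)

/-- The `h`-limited distance `d_h(u,v)`, the least weight of a `u`-`v`-path with at most `h` edges;
it is `⊤` if there is no such path. -/
noncomputable def hopDist (h : ℕ) (u v : Fin n) : ℕ∞ :=
  ⨅ p : {p : G.graph.Path u v // p.1.length ≤ h}, (G.pathWeight p.1 : ℕ∞)

/-- The shortest-path diameter: the least `h` with `d_h(u,v) = d(u,v)` for all `u, v`. -/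
noncomputable def spd : ℕ :=
  sInf {h : ℕ | ∀ u v, G.hopDist h u v = G.dist u v}

end WeightedGraph

/-- What a node knows initially (besides the number `n` of nodes): its identifier, whether it is the
source, and, for every node `u`, whether `u` is a neighbor and then the weight of the edge to it. -/
structure NodeInput (n : ℕ) where
  id : Fin n
  isSource : Bool
  edgeWeight : Fin n → Option ℕ

open Classical in
/-- The initial knowledge of node `v` in the graph `G` with source `s`. -/
noncomputable def WeightedGraph.nodeInput {n : ℕ} (G : WeightedGraph n) (s v : Fin n) :
    NodeInput n where
  id := v
  isSource := decide (v = s)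
  edgeWeight u := if G.graph.Adj v u then some (G.weight s(v, u)) else none

/-- A randomized node program for SSSP in the hybrid network on `n` nodes with messages of `b` bits,
local capacity `∞` and global capacity `γ`. All nodes run the same program. In every round a node
that has not terminated draws a fresh private uniformly random value from `Fin coins`, sends
messages, and computes its next state from the messages that it receives. Local computation is
unrestricted. -/
structure Program (n γ b : ℕ) where
  State : Type
  coins : ℕ
  coins_pos : 0 < coins
  init : NodeInput n → State
  /-- `some d` means that the node has terminated with output `d`; `none` that it is running. -/
  output : State → Option ℕ∞
  /-- The messages, in any number, sent to a neighbor over the local edge. -/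
  sendLocal : State → Fin coins → Fin n → List (BitVec b)
  /-- The at most `γ` messages sent over global edges, each with its target node. -/
  sendGlobal : State → Fin coins → Fin γ → Option (Fin n × BitVec b)
  /-- The next state, from the local messages received from each node and the multiset of the
  global messages received, each with its sender. -/
  update : State → Fin coins → (Fin n → List (BitVec b)) → Multiset (Fin n × BitVec b) → State

namespace Program

variable {n γ b : ℕ} (P : Program n γ b)

open Classical in
/-- The local messages that reach `v` from `u` in a round that starts with the states `σ` and in
which the nodes draw the values `r`. They travel along edges of the graph only, all of them are
delivered, and terminated nodes send nothing. -/
noncomputable def localInbox (G : WeightedGraph n) (r : Fin n → Fin P.coins) (σ : Fin n → P.State)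
    (v u : Fin n) : List (BitVec b) :=
  if G.graph.Adj u v ∧ P.output (σ u) = none then P.sendLocal (σ u) (r u) v else []

/-- The multiset of all global messages, with their senders, that are sent to `v` in a round.
Terminated nodes send nothing. -/
def globalSent (r : Fin n → Fin P.coins) (σ : Fin n → P.State) (v : Fin n) :
    Multiset (Fin n × BitVec b) :=
  (Finset.univ : Finset (Fin n × Fin γ)).val.filterMap fun a =>
    if P.output (σ a.1) = none then
      (P.sendGlobal (σ a.1) (r a.1) a.2).bind fun m => if m.1 = v then some (a.1, m.2) else none
    else none

/-- `delivered` is an admissible delivery of the multiset `sent` of global messages sent to a node: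
everything arrives if there are at most `γ` messages; otherwise an adversary picks an arbitrary
part of at most `γ` of them, and the others are dropped. -/
def AdmissibleDelivery (γ : ℕ) {α : Type} (sent delivered : Multiset α) : Prop :=
  delivered ≤ sent ∧ Multiset.card delivered ≤ γ ∧
    (Multiset.card sent ≤ γ → delivered = sent)

/-- `σ'` are possible states of the nodes after a round that starts with the states `σ` and in which
the nodes draw the values `r`. Terminated nodes keep their state. -/
def Step (G : WeightedGraph n) (r : Fin n → Fin P.coins) (σ σ' : Fin n → P.State) : Prop :=
  ∃ D : Fin n → Multiset (Fin n × BitVec b),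
    (∀ v, AdmissibleDelivery γ (P.globalSent r σ v) (D v)) ∧
    ∀ v, σ' v = if P.output (σ v) = none then
        P.update (σ v) (r v) (P.localInbox G r σ v) (D v)
      else σ v

/-- `σ 0, …, σ T` is a possible execution of `T` rounds on the graph `G` with source `s`, where
`ω t v` is the value drawn by node `v` in round `t`. -/
def IsExecution (G : WeightedGraph n) (s : Fin n) {T : ℕ} (ω : Fin T → Fin n → Fin P.coins)
    (σ : ℕ → Fin n → P.State) : Prop :=
  (∀ v, σ 0 v = P.init (G.nodeInput s v)) ∧ ∀ t : Fin T, P.Step G (ω t) (σ t) (σ (t + 1))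

/-- With the random values `ω`, whatever the adversary does, after `T` rounds every node has
terminated with its exact distance to the source as output. -/
def SolvesWith (G : WeightedGraph n) (s : Fin n) {T : ℕ} (ω : Fin T → Fin n → Fin P.coins) :
    Prop :=
  ∀ σ : ℕ → Fin n → P.State, P.IsExecution G s ω σ →
    ∀ v, P.output (σ T v) = some (G.dist v s)

/-- The probability, over independent uniform random values of all nodes in all rounds, that SSSP
is solved exactly within `T` rounds. -/
noncomputable def successProb (G : WeightedGraph n) (s : Fin n) (T : ℕ) : ℝ :=
  (Nat.card {ω : Fin T → Fin n → Fin P.coins // P.SolvesWith G s ω} : ℝ) /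
    (Nat.card (Fin T → Fin n → Fin P.coins) : ℝ)

end Program

end Hybrid

/-! Single-source shortest paths in the hybrid network in `Õ(√SPD)` rounds. The algorithm is
deterministic, hence correct with probability one.

For `t = 1, 2, 4, …`, the nodes first learn their surroundings up to `2 * t` edges over local edges.
Then there are `t` phases; phase `i` extends the distances from the nodes whose shortest paths have
at most `i * t` edges to those with at most `(i + 1) * t` edges. In a phase every node `u` at hop
number `i * t` spreads its distance along a shortest-path tree of its surroundings, which takes a
logarithmic number of rounds of messages to all children and of messages along exponentially growing
jumps to descendants whose subtrees have about the same size. Messages to the same target are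
reduced to the best one by a sorting network, so that no node receives more than one global message
at a time. At the end the nodes verify the distances and terminate if they are correct. -/

/-! Give an edge of weight `c` the scaled weight `n * c + 1`. Shortest paths have fewer than `n`
edges, so a scaled distance `z` from the source encodes both the distance `z / n` and the least
number `z % n` of edges of a shortest path, the hop number, which is at most `spd`
(`scaledDist_spec`). Local edges carry unlimited information, so after `2 * t` rounds every node
knows the ball of radius `t` around each node `u` within `t` edges. As `parent` depends only on this
ball and on `u`, all nodes near `u` agree on one shortest-path tree rooted at `u`.

In a phase with parameter `l`, the roots are the nodes whose bound is `l` modulo `n`. A root `u`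
proposes to `v` its bound plus the distance from `u` to `v` inside its ball; proposals are compared
by value, then by root. For a node of hop number between `l` and `l + t` the best proposal is exact
(`exists_served`), and the nodes served by one root are closed under taking parents in its tree
(`served_parent`). Hence the best proposal can travel down the tree through nodes for which the same
root is best. Other messages do no harm: every offer is a genuine proposal, so none is below the
best one.

Travelling `t` levels must take only polylogarithmic time. Let the rank of a node be the logarithm
of the size of its subtree. Ranks grow towards the root and take few values. On each level below `v`
at most one descendant has the rank of `v` (`eq_of_up_of_rank_eq`), so a jump of given length from
`v` has a unique target. A message to the children lowers the rank, and jumps of lengths `1, 2, 4,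
…` cover a path of constant rank (`Spreads.reach`).

Trees of different roots overlap, so many jumps may address the same node. A sorting network orders
the items by target and then by proposal; only the first item of each target is delivered
(`wp_aggregate`). Every operation thus sends and receives at most one global message per node, the
adversary has no choice (`step_cons`), and no randomness is needed.

A stage of `t` phases handles hop numbers up to `t * t` in `O(t log⁴ n)` rounds. Sound bounds that
respect every edge are exact (`eq_scaledDist_of_consistent`), so a stage certifies its own result
without knowledge of `spd`. Doubling `t` until `t * t ≥ spd` costs a geometric sum. -/

namespace Hybrid

/-! ### A sorting network -/

section Sorting

variable {α β : Type*} [LinearOrder α] [LinearOrder β]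

/-- One layer of a comparator network on the wires `ℕ`: wire `i` is compared with wire `p i`, and
the smaller value moves to the smaller index. -/
def layer (p : ℕ → ℕ) (f : ℕ → α) (i : ℕ) : α :=
  if i < p i then min (f i) (f (p i)) else max (f i) (f (p i))

/-- The reflection of every aligned block of `m` wires. -/
def flip (m i : ℕ) : ℕ := m * (i / m) + (m - 1 - i % m)

/-- In every aligned block of `2 * h` wires, the exchange of the two halves. -/
def swap (h i : ℕ) : ℕ := if i % (2 * h) < h then i + h else i - h

lemma flip_apply {m b r : ℕ} (hr : r < m) : flip m (m * b + r) = m * b + (m - 1 - r) := by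
  have hm : 0 < m := by omega
  simp [flip, Nat.mul_add_div hm, Nat.div_eq_of_lt hr, Nat.mod_eq_of_lt hr]

lemma swap_apply_lower {h b r : ℕ} (hr : r < h) : swap h (2 * h * b + r) = 2 * h * b + (h + r) := by
  have : r % (2 * h) = r := Nat.mod_eq_of_lt (by omega)
  simp [swap, this, hr]; omega

lemma swap_apply_upper {h b r : ℕ} (hr : r < h) :
    swap h (2 * h * b + (h + r)) = 2 * h * b + r := by
  have : (h + r) % (2 * h) = h + r := Nat.mod_eq_of_lt (by omega)
  simp [swap, this]; omega

lemma exists_block {m : ℕ} (hm : 0 < m) (i : ℕ) : ∃ b r, r < m ∧ i = m * b + r :=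
  ⟨i / m, i % m, Nat.mod_lt _ hm, (Nat.div_add_mod i m).symm⟩

lemma flip_flip {m : ℕ} (hm : 0 < m) (i : ℕ) : flip m (flip m i) = i := by
  obtain ⟨b, r, hr, rfl⟩ := exists_block hm i
  rw [flip_apply hr, flip_apply (by omega)]; omega

lemma swap_swap {h : ℕ} (hh : 0 < h) (i : ℕ) : swap h (swap h i) = i := by
  obtain ⟨b, r, hr, rfl⟩ := exists_block (show 0 < 2 * h by omega) i
  rcases lt_or_ge r h with hlt | hge
  · rw [swap_apply_lower hlt, swap_apply_upper hlt]
  · obtain ⟨r, rfl⟩ := Nat.exists_eq_add_of_le hge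
    rw [swap_apply_upper (by omega), swap_apply_lower (by omega)]

/-- The layers that sort all aligned blocks of `2 ^ j` wires that hold bitonic sequences. -/
def mergeNet : ℕ → List (ℕ → ℕ)
  | 0 => []
  | j + 1 => swap (2 ^ j) :: mergeNet j

/-- The layers that sort all aligned blocks of `2 ^ k` wires. -/
def sortNet : ℕ → List (ℕ → ℕ)
  | 0 => []
  | k + 1 => sortNet k ++ flip (2 ^ (k + 1)) :: mergeNet k

/-- The effect of a comparator network. -/
def runNet (l : List (ℕ → ℕ)) (f : ℕ → α) : ℕ → α := l.foldl (fun g p => layer p g) f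

@[simp] lemma runNet_cons (p : ℕ → ℕ) (l : List (ℕ → ℕ)) (f : ℕ → α) :
    runNet (p :: l) f = runNet l (layer p f) := rfl

lemma runNet_append (l l' : List (ℕ → ℕ)) (f : ℕ → α) :
    runNet (l ++ l') f = runNet l' (runNet l f) := by
  simp [runNet, List.foldl_append]

lemma length_mergeNet (j : ℕ) : (mergeNet j).length = j := by
  induction j with
  | zero => rfl
  | succ j ih => simp [mergeNet, ih]

lemma length_sortNet_le (k : ℕ) : (sortNet k).length ≤ k * k := by
  induction k with
  | zero => simp [sortNet]
  | succ k ih => simp [sortNet, length_mergeNet]; nlinarith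

lemma involutive_of_mem_mergeNet {j : ℕ} {p : ℕ → ℕ} (hp : p ∈ mergeNet j) :
    Function.Involutive p := by
  induction j with
  | zero => simp [mergeNet] at hp
  | succ j ih =>
    simp only [mergeNet, List.mem_cons] at hp
    rcases hp with rfl | hp
    · exact swap_swap (by positivity)
    · exact ih hp

lemma involutive_of_mem_sortNet {k : ℕ} {p : ℕ → ℕ} (hp : p ∈ sortNet k) :
    Function.Involutive p := by
  induction k with
  | zero => simp [sortNet] at hp
  | succ k ih =>
    simp only [sortNet, List.mem_append, List.mem_cons] at hp
    rcases hp with hp | rfl | hp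
    · exact ih hp
    · exact flip_flip (by positivity)
    · exact involutive_of_mem_mergeNet hp

lemma layer_comp {φ : α → β} (hφ : Monotone φ) (p : ℕ → ℕ) (f : ℕ → α) :
    layer p (φ ∘ f) = φ ∘ layer p f := by
  funext i
  simp only [layer, Function.comp]
  split_ifs
  · exact (hφ.map_min).symm
  · exact (hφ.map_max).symm

lemma runNet_comp {φ : α → β} (hφ : Monotone φ) (l : List (ℕ → ℕ)) (f : ℕ → α) :
    runNet l (φ ∘ f) = φ ∘ runNet l f := by
  induction l generalizing f with
  | nil => rfl
  | cons p l ih => rw [runNet_cons, layer_comp hφ, ih, runNet_cons]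

/-- The `m` wires from `b` on hold a bitonic sequence of bits. -/
def Bitonic (f : ℕ → Bool) (b m : ℕ) : Prop :=
  ∃ (p q : ℕ) (v : Bool), ∀ i < m, f (b + i) = if p ≤ i ∧ i < q then v else !v

lemma layer_swap_lower (f : ℕ → α) {h b r : ℕ} (hr : r < h) :
    layer (swap h) f (2 * h * b + r) =
      min (f (2 * h * b + r)) (f (2 * h * b + (h + r))) := by
  simp only [layer, swap_apply_lower hr]
  rw [if_pos (by omega)]

lemma layer_swap_upper (f : ℕ → α) {h b r : ℕ} (hr : r < h) :
    layer (swap h) f (2 * h * b + (h + r)) =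
      max (f (2 * h * b + r)) (f (2 * h * b + (h + r))) := by
  simp only [layer, swap_apply_upper hr]
  rw [if_neg (by omega), max_comm]

/-- The half-cleaner. The bits equal to `v` form an interval, and comparing positions at distance
`h` overlays its traces on the two halves: one half becomes constant with its final value, the other
stays bitonic. -/
lemma layer_swap_bitonic {f : ℕ → Bool} {h b : ℕ}
    (hf : Bitonic f (2 * h * b) (2 * h)) :
    Bitonic (layer (swap h) f) (2 * h * b) h ∧ Bitonic (layer (swap h) f) (2 * h * b + h) h ∧
    ((∀ i < h, layer (swap h) f (2 * h * b + i) = false) ∨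
      ∀ i < h, layer (swap h) f (2 * h * b + h + i) = true) := by
  obtain ⟨p, q, v, hv⟩ := hf
  have lo : ∀ i < h, layer (swap h) f (2 * h * b + i) =
      min (if p ≤ i ∧ i < q then v else !v) (if p ≤ h + i ∧ h + i < q then v else !v) := by
    intro i hi
    rw [layer_swap_lower f hi, hv i (by omega), hv (h + i) (by omega)]
  have up : ∀ i < h, layer (swap h) f (2 * h * b + h + i) =
      max (if p ≤ i ∧ i < q then v else !v) (if p ≤ h + i ∧ h + i < q then v else !v) := by
    intro i hi
    rw [add_assoc, layer_swap_upper f hi, hv i (by omega), hv (h + i) (by omega)]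
  cases v
  · refine ⟨?_, ?_, ?_⟩
    · rcases le_or_gt q h with hq | hq
      · exact ⟨p, q, false, fun i hi => by rw [lo i hi]; split_ifs <;> simp <;> omega⟩
      rcases le_or_gt h p with hp | hp
      · exact ⟨p - h, q - h, false, fun i hi => by rw [lo i hi]; split_ifs <;> simp <;> omega⟩
      · exact ⟨q - h, p, true, fun i hi => by rw [lo i hi]; split_ifs <;> simp <;> omega⟩
    · exact ⟨p, q - h, false, fun i hi => by rw [up i hi]; split_ifs <;> simp <;> omega⟩
    · by_cases hpq : p < q - h ∧ p < h
      · left; intro i hi; rw [lo i hi]; split_ifs <;> simp; omega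
      · right; intro i hi; rw [up i hi]; split_ifs <;> simp; omega
  · refine ⟨?_, ?_, ?_⟩
    · exact ⟨p, q - h, true, fun i hi => by rw [lo i hi]; split_ifs <;> simp <;> omega⟩
    · rcases le_or_gt q h with hq | hq
      · exact ⟨p, q, true, fun i hi => by rw [up i hi]; split_ifs <;> simp <;> omega⟩
      rcases le_or_gt h p with hp | hp
      · exact ⟨p - h, q - h, true, fun i hi => by rw [up i hi]; split_ifs <;> simp <;> omega⟩
      · exact ⟨q - h, p, false, fun i hi => by rw [up i hi]; split_ifs <;> simp <;> omega⟩
    · by_cases hpq : p < q - h ∧ p < h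
      · right; intro i hi; rw [up i hi]; split_ifs <;> simp; omega
      · left; intro i hi; rw [lo i hi]; split_ifs <;> simp; omega

/-- All comparators of `mergeNet j` stay inside aligned blocks of `2 ^ j` wires, so the half that
`layer_swap_bitonic` has cleaned is not disturbed. -/
lemma runNet_mergeNet_const {f : ℕ → α} (v : α) (j b : ℕ)
    (hf : ∀ i < 2 ^ j, f (2 ^ j * b + i) = v) :
    ∀ i < 2 ^ j, runNet (mergeNet j) f (2 ^ j * b + i) = v := by
  induction j generalizing f b with
  | zero => exact hf
  | succ j ih =>
    have e : 2 ^ (j + 1) = 2 * 2 ^ j := by ring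
    have e2 : 2 ^ (j + 1) * b = 2 ^ j * (2 * b) := by ring
    have e3 : 2 ^ (j + 1) * b + 2 ^ j = 2 ^ j * (2 * b + 1) := by ring
    intro i hi
    simp only [mergeNet, runNet_cons]
    rcases lt_or_ge i (2 ^ j) with h | h
    · rw [e2]
      refine ih (2 * b) (fun r hr => ?_) i h
      rw [← e2, e, layer_swap_lower f hr, ← e, hf _ (by omega), hf _ (by omega), min_self]
    · obtain ⟨i, rfl⟩ := Nat.exists_eq_add_of_le h
      rw [← add_assoc, e3]
      refine ih (2 * b + 1) (fun r hr => ?_) i (by omega)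
      rw [← e3, e, add_assoc, layer_swap_upper f hr, ← e, hf _ (by omega), hf _ (by omega),
        max_self]

lemma runNet_mergeNet_bitonic {f : ℕ → Bool} (j b : ℕ) (hf : Bitonic f (2 ^ j * b) (2 ^ j)) :
    ∀ i i', i ≤ i' → i' < 2 ^ j →
      runNet (mergeNet j) f (2 ^ j * b + i) ≤ runNet (mergeNet j) f (2 ^ j * b + i') := by
  induction j generalizing f b with
  | zero =>
    intro i i' h h'
    obtain rfl : i = i' := by simp at h'; omega
    exact le_rfl
  | succ j ih =>
    have e : 2 ^ (j + 1) = 2 * 2 ^ j := by ring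
    have e2 : 2 ^ (j + 1) * b = 2 ^ j * (2 * b) := by ring
    have e3 : 2 ^ (j + 1) * b + 2 ^ j = 2 ^ j * (2 * b + 1) := by ring
    rw [e] at hf
    obtain ⟨h1, h2, h3⟩ := layer_swap_bitonic hf
    rw [← e] at h1 h2 h3
    rw [e2] at h1
    rw [e3] at h2
    intro i i' hii hi'
    simp only [mergeNet, runNet_cons]
    rcases lt_or_ge i' (2 ^ j) with h' | h'
    · rw [e2]; exact ih _ h1 i i' hii h'
    obtain ⟨i', rfl⟩ := Nat.exists_eq_add_of_le h'
    rcases lt_or_ge i (2 ^ j) with h | h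
    · rcases h3 with h3 | h3
      · rw [e2] at h3 ⊢
        rw [runNet_mergeNet_const false j _ h3 i h]
        exact Bool.false_le _
      · rw [e3] at h3
        rw [← add_assoc, e3, runNet_mergeNet_const true j _ h3 i' (by omega)]
        exact Bool.le_true _
    · obtain ⟨i, rfl⟩ := Nat.exists_eq_add_of_le h
      rw [← add_assoc, ← add_assoc, e3]
      exact ih _ h2 i i' (by omega) (by omega)

lemma exists_threshold {f : ℕ → Bool} {b m : ℕ}
    (hf : ∀ i i', i ≤ i' → i' < m → f (b + i) ≤ f (b + i')) :
    ∃ p ≤ m, ∀ i < m, f (b + i) = decide (p ≤ i) := by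
  induction m with
  | zero => exact ⟨0, le_rfl, by simp⟩
  | succ m ih =>
    obtain ⟨p, hp, h⟩ := ih fun i i' h h' => hf i i' h (by omega)
    cases hm : f (b + m)
    · refine ⟨m + 1, le_rfl, fun i hi => ?_⟩
      have := hf i m (by omega) (by omega)
      rw [hm] at this
      rw [Bool.eq_false_of_le_false this]; simp; omega
    · refine ⟨p, by omega, fun i hi => ?_⟩
      rcases Nat.lt_succ_iff_lt_or_eq.mp hi with h' | rfl
      · exact h i h'
      · rw [hm]; simp [hp]

/-- Two sorted halves, the second one read backwards, form a bitonic sequence; the reflection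
compares exactly the corresponding positions. The thresholds `p` and `q` count the zeros of the
halves, so `h ≤ p + q` means that zeros fill the lower half. -/
lemma layer_flip_bitonic {f : ℕ → Bool} {h b : ℕ}
    (hf : ∀ i i', i ≤ i' → i' < h → f (2 * h * b + i) ≤ f (2 * h * b + i'))
    (hf' : ∀ i i', i ≤ i' → i' < h → f (2 * h * b + h + i) ≤ f (2 * h * b + h + i')) :
    Bitonic (layer (flip (2 * h)) f) (2 * h * b) h ∧
    Bitonic (layer (flip (2 * h)) f) (2 * h * b + h) h ∧
    ((∀ i < h, layer (flip (2 * h)) f (2 * h * b + i) = false) ∨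
      ∀ i < h, layer (flip (2 * h)) f (2 * h * b + h + i) = true) := by
  obtain ⟨p, hp, hp'⟩ := exists_threshold hf
  obtain ⟨q, hq, hq'⟩ := exists_threshold hf'
  have lo : ∀ i < h, layer (flip (2 * h)) f (2 * h * b + i) =
      min (decide (p ≤ i)) (decide (q ≤ h - 1 - i)) := by
    intro i hi
    have e : 2 * h * b + (2 * h - 1 - i) = 2 * h * b + h + (h - 1 - i) := by omega
    simp only [layer, flip_apply (show i < 2 * h by omega)]
    rw [if_pos (by omega), hp' i hi, e, hq' _ (by omega)]
  have up : ∀ i < h, layer (flip (2 * h)) f (2 * h * b + h + i) =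
      max (decide (q ≤ i)) (decide (p ≤ h - 1 - i)) := by
    intro i hi
    have e : 2 * h * b + (2 * h - 1 - (h + i)) = 2 * h * b + (h - 1 - i) := by omega
    simp only [layer]
    rw [add_assoc, flip_apply (show h + i < 2 * h by omega), if_neg (by omega), ← add_assoc,
      hq' i hi, e, hp' _ (by omega)]
  refine ⟨⟨p, h - q, true, fun i hi => ?_⟩, ⟨h - p, q, false, fun i hi => ?_⟩, ?_⟩
  · rw [lo i hi]
    split_ifs <;> simp [Bool.min_eq_and] <;> omega
  · rw [up i hi]
    split_ifs <;> simp [Bool.max_eq_or] <;> omega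
  · by_cases hpq : h ≤ p + q
    · left; intro i hi; rw [lo i hi]; simp [Bool.min_eq_and]; omega
    · right; intro i hi; rw [up i hi]; simp [Bool.max_eq_or]; omega

lemma runNet_sortNet_bool (f : ℕ → Bool) (k b : ℕ) :
    ∀ i i', i ≤ i' → i' < 2 ^ k →
      runNet (sortNet k) f (2 ^ k * b + i) ≤ runNet (sortNet k) f (2 ^ k * b + i') := by
  induction k generalizing b with
  | zero =>
    intro i i' h h'
    obtain rfl : i = i' := by simp at h'; omega
    exact le_rfl
  | succ j ih =>
    have e : 2 ^ (j + 1) = 2 * 2 ^ j := by ring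
    have e2 : 2 * 2 ^ j * b = 2 ^ j * (2 * b) := by ring
    have e3 : 2 * 2 ^ j * b + 2 ^ j = 2 ^ j * (2 * b + 1) := by ring
    obtain ⟨h1, h2, h3⟩ := layer_flip_bitonic (f := runNet (sortNet j) f) (h := 2 ^ j) (b := b)
      (by rw [e2]; exact ih (2 * b)) (by rw [e3]; exact ih (2 * b + 1))
    rw [e2] at h1
    rw [e3] at h2
    intro i i' hii hi'
    simp only [sortNet, runNet_append, runNet_cons, e]
    rcases lt_or_ge i' (2 ^ j) with h' | h'
    · rw [e2]; exact runNet_mergeNet_bitonic _ _ h1 i i' hii h'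
    obtain ⟨i', rfl⟩ := Nat.exists_eq_add_of_le h'
    rcases lt_or_ge i (2 ^ j) with h | h
    · rcases h3 with h3 | h3
      · rw [e2] at h3 ⊢
        rw [runNet_mergeNet_const false j _ h3 i h]
        exact Bool.false_le _
      · rw [e3] at h3
        rw [← add_assoc, e3, runNet_mergeNet_const true j _ h3 i' (by omega)]
        exact Bool.le_true _
    · obtain ⟨i, rfl⟩ := Nat.exists_eq_add_of_le h
      rw [← add_assoc, ← add_assoc, e3]
      exact runNet_mergeNet_bitonic _ _ h2 i i' (by omega) (by omega)

/-- `sortNet k` sorts `2 ^ k` values (by the zero-one principle). -/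
theorem runNet_sortNet_le (f : ℕ → α) {k i i' : ℕ} (hii : i ≤ i') (hi' : i' < 2 ^ k) :
    runNet (sortNet k) f i ≤ runNet (sortNet k) f i' := by
  by_contra! hlt
  set a := runNet (sortNet k) f i' with ha
  -- Thresholding at the value `a` of wire `i'` would leave `true` on wire `i` and `false` on wire
  -- `i'`, against the case of bits.
  have hφ : Monotone fun c : α => decide (a < c) := by
    intro c d hcd
    by_cases hc : a < c
    · simp [hc, hc.trans_le hcd]
    · simp [hc]
  have := runNet_sortNet_bool ((fun c : α => decide (a < c)) ∘ f) k 0 i i' hii hi'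
  rw [runNet_comp hφ] at this
  simp [hlt, ← ha] at this
  exact absurd this (by decide)

/-- The restriction of an involution to the wires below `n`; the other wires become idle. -/
def restrict (n : ℕ) (p : ℕ → ℕ) (i : Fin n) : Fin n := if h : p i < n then ⟨p i, h⟩ else i

lemma restrict_involutive (n : ℕ) {p : ℕ → ℕ} (hp : Function.Involutive p) :
    Function.Involutive (restrict n p) := by
  intro i
  unfold restrict
  by_cases h : p i < n
  · simp [h, hp (i : ℕ)]
  · simp [h]

/-- A layer of a comparator network on `n` wires. -/
def finLayer {n : ℕ} (p : Fin n → Fin n) (f : Fin n → α) (i : Fin n) : α :=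
  if i < p i then min (f i) (f (p i)) else max (f i) (f (p i))

/-- Multiplicities need not be tracked: the aggregation only uses which items are present. -/
lemma range_finLayer {n : ℕ} {p : Fin n → Fin n} (hp : Function.Involutive p) (f : Fin n → α) :
    Set.range (finLayer p f) = Set.range f := by
  ext a
  simp only [Set.mem_range]
  constructor
  · rintro ⟨i, rfl⟩
    unfold finLayer
    split_ifs
    · rcases min_choice (f i) (f (p i)) with h | h <;> exact ⟨_, h.symm⟩
    · rcases max_choice (f i) (f (p i)) with h | h <;> exact ⟨_, h.symm⟩
  · rintro ⟨i, rfl⟩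
    rcases lt_trichotomy i (p i) with h | h | h
    · rcases le_total (f i) (f (p i)) with h' | h'
      · exact ⟨i, by simp [finLayer, h, h']⟩
      · exact ⟨p i, by simp [finLayer, hp i, h.not_gt, h']⟩
    · exact ⟨i, by simp [finLayer, ← h]⟩
    · rcases le_total (f i) (f (p i)) with h' | h'
      · exact ⟨p i, by simp [finLayer, hp i, h, h']⟩
      · exact ⟨i, by simp [finLayer, h.not_gt, h']⟩

/-- Values on `n` wires, extended by `⊤` to the other wires. -/
def extendTop [OrderTop α] {n : ℕ} (f : Fin n → α) (i : ℕ) : α := if h : i < n then f ⟨i, h⟩ else ⊤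

/-- Comparators move the smaller value to the smaller index, so a padding value `⊤` above wire `n`
never moves below it. This allows `n` not to be a power of two. -/
lemma layer_extendTop [OrderTop α] {n : ℕ} (p : ℕ → ℕ) (f : Fin n → α) :
    layer p (extendTop f) = extendTop (finLayer (restrict n p) f) := by
  funext i
  by_cases hi : i < n <;> by_cases hpi : p i < n
  · simp [layer, extendTop, finLayer, restrict, hi, hpi]
  · have : i < p i := by omega
    simp [layer, extendTop, finLayer, restrict, hi, hpi, this]
  · have : ¬ i < p i := by omega
    simp [layer, extendTop, hi, hpi, this]
  · simp [layer, extendTop, hi, hpi]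

/-- The effect of a comparator network on `n` wires. -/
def runFin (n : ℕ) (l : List (ℕ → ℕ)) (f : Fin n → α) : Fin n → α :=
  l.foldl (fun g p => finLayer (restrict n p) g) f

lemma runNet_extendTop [OrderTop α] {n : ℕ} (l : List (ℕ → ℕ)) (f : Fin n → α) :
    runNet l (extendTop f) = extendTop (runFin n l f) := by
  induction l generalizing f with
  | nil => rfl
  | cons p l ih =>
    rw [runNet_cons, layer_extendTop, ih]
    rfl

theorem monotone_runFin_sortNet [OrderTop α] {n k : ℕ} (hn : n ≤ 2 ^ k) (f : Fin n → α) :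
    Monotone (runFin n (sortNet k) f) := by
  intro i i' hii
  have := runNet_sortNet_le (extendTop f) (show (i : ℕ) ≤ i' from hii) (i'.2.trans_le hn)
  rw [runNet_extendTop] at this
  simpa [extendTop] using this

theorem range_runFin {n : ℕ} {l : List (ℕ → ℕ)} (hl : ∀ p ∈ l, Function.Involutive p)
    (f : Fin n → α) : Set.range (runFin n l f) = Set.range f := by
  induction l generalizing f with
  | nil => rfl
  | cons p l ih =>
    have := ih (fun p hp => hl p (by simp [hp])) (finLayer (restrict n p) f)
    rw [range_finLayer (restrict_involutive n (hl p (by simp)))] at this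
    exact this

end Sorting

/-! ### Long-range descendants in a forest -/

section Forest

variable {V : Type*}

/-- The ancestor of `w` that is `j` levels above `w` in the forest with parent function `par`. -/
def up (par : V → Option V) : ℕ → V → Option V
  | 0, w => some w
  | j + 1, w => (par w).bind (up par j)

variable {par : V → Option V}

@[simp] lemma up_zero (w : V) : up par 0 w = some w := rfl

lemma up_succ {w w' : V} (h : par w = some w') (j : ℕ) : up par (j + 1) w = up par j w' := by
  simp [up, h]

lemma up_one (w : V) : up par 1 w = par w := by
  cases h : par w <;> simp [up, h]

lemma up_add (i j : ℕ) (w : V) : up par (i + j) w = (up par i w).bind (up par j) := by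
  induction i generalizing w with
  | zero => simp
  | succ i ih =>
    rw [Nat.add_right_comm]
    cases h : par w <;> simp [up, h, ih]

lemma of_up_of_closed {good : V → Prop} (closed : ∀ w v, good w → par w = some v → good v) {j : ℕ}
    {w v : V} (hw : good w) (hv : up par j w = some v) : good v := by
  induction j generalizing w with
  | zero => simp at hv; exact hv ▸ hw
  | succ j ih =>
    cases hp : par w with
    | none => simp [up, hp] at hv
    | some z => exact ih (closed w z hw hp) (by rwa [up_succ hp] at hv)

lemma up_trans {i j : ℕ} {w v z : V} (h : up par i w = some v) (h' : up par j v = some z) :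
    up par (i + j) w = some z := by
  simp [up_add, h, h']

lemma exists_up_of_le {i j : ℕ} {w v : V} (hij : i ≤ j) (h : up par j w = some v) :
    ∃ z, up par i w = some z ∧ up par (j - i) z = some v := by
  obtain ⟨d, rfl⟩ := Nat.exists_eq_add_of_le hij
  rw [up_add] at h
  simpa using Option.bind_eq_some_iff.mp h

section Potential

variable {δ : V → ℕ} (hδ : ∀ w v, par w = some v → δ v < δ w)
include hδ

lemma add_le_of_up {j : ℕ} {w v : V} (h : up par j w = some v) : δ v + j ≤ δ w := by
  induction j generalizing w with
  | zero => simp at h; simp [h]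
  | succ j ih =>
    cases hp : par w with
    | none => simp [up, hp] at h
    | some z =>
      rw [up_succ hp] at h
      have := ih h
      have := hδ w z hp
      omega

lemma eq_zero_of_up_self {j : ℕ} {v : V} (h : up par j v = some v) : j = 0 := by
  have := add_le_of_up hδ h
  omega

end Potential

variable [Fintype V]

open Classical in
/-- The nodes of the subtree below `v`. -/
noncomputable def subtree (par : V → Option V) (v : V) : Finset V :=
  Finset.univ.filter fun x => ∃ j, up par j x = some v

lemma mem_subtree {v x : V} : x ∈ subtree par v ↔ ∃ j, up par j x = some v := by
  simp [subtree]

lemma self_mem_subtree (v : V) : v ∈ subtree par v := mem_subtree.mpr ⟨0, rfl⟩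

lemma subtree_subset {j : ℕ} {w v : V} (h : up par j w = some v) :
    subtree par w ⊆ subtree par v := by
  intro x hx
  obtain ⟨i, hi⟩ := mem_subtree.mp hx
  exact mem_subtree.mpr ⟨i + j, up_trans hi h⟩

/-- The binary logarithm of the size of the subtree below `v`. -/
noncomputable def rank (par : V → Option V) (v : V) : ℕ := Nat.log 2 (subtree par v).card

lemma rank_le_rank {j : ℕ} {w v : V} (h : up par j w = some v) : rank par w ≤ rank par v :=
  Nat.log_mono_right (Finset.card_le_card (subtree_subset h))

lemma rank_le_log (v : V) : rank par v ≤ Nat.log 2 (Fintype.card V) :=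
  Nat.log_mono_right (Finset.card_le_univ _)

section Potential

variable {δ : V → ℕ} (hδ : ∀ w v, par w = some v → δ v < δ w)
include hδ

/-- Each step upwards adds at least the new ancestor itself, which the potential keeps out of the
smaller subtree. -/
lemma card_subtree_add_le {j : ℕ} {w v : V} (h : up par j w = some v) :
    (subtree par w).card + j ≤ (subtree par v).card := by
  induction j generalizing w with
  | zero => simp at h; simp [h]
  | succ j ih =>
    cases hp : par w with
    | none => simp [up, hp] at h
    | some z =>
      rw [up_succ hp] at h
      have h1 := ih h
      have hz : up par 1 w = some z := by rw [up_one, hp]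
      have h2 : (subtree par w).card < (subtree par z).card := by
        refine Finset.card_lt_card (Finset.ssubset_iff_of_subset (subtree_subset hz) |>.mpr
          ⟨z, self_mem_subtree z, fun hmem => ?_⟩)
        obtain ⟨i, hi⟩ := mem_subtree.mp hmem
        have := eq_zero_of_up_self hδ (up_trans hi hz)
        omega
      omega

lemma lt_card_of_up {j : ℕ} {w v : V} (h : up par j w = some v) : j < Fintype.card V := by
  have h1 := card_subtree_add_le hδ h
  have h2 := Finset.card_le_univ (subtree par v)
  have h3 := Finset.card_pos.mpr ⟨w, self_mem_subtree (par := par) w⟩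
  omega

/-- On every level below `v` at most one descendant has the same rank as `v`. -/
lemma eq_of_up_of_rank_eq {j : ℕ} {w₁ w₂ v : V} (h₁ : up par j w₁ = some v)
    (h₂ : up par j w₂ = some v) (r₁ : rank par w₁ = rank par v) (r₂ : rank par w₂ = rank par v) :
    w₁ = w₂ := by
  classical
  by_contra hne
  -- Two ancestors of a common node lie on one path; being equally far below `v`, they coincide.
  have key : ∀ {w₁ w₂ x : V} {a b : ℕ}, up par j w₁ = some v → up par j w₂ = some v →
      a ≤ b → up par a x = some w₁ → up par b x = some w₂ → w₁ = w₂ := by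
    intro w₁ w₂ x a b h₁ h₂ hab ha hb
    obtain ⟨z, hz, hz'⟩ := exists_up_of_le hab hb
    obtain rfl : w₁ = z := by simpa [ha] using hz
    have h3 := up_trans hz' h₂
    rw [Nat.add_comm, up_add, h₁] at h3
    have h4 := eq_zero_of_up_self hδ (show up par (b - a) v = some v from h3)
    rw [h4] at hz'
    simpa using hz'
  -- Two disjoint subtrees with at least `2 ^ rank` nodes each would raise the rank of `v`.
  have hdisj : Disjoint (subtree par w₁) (subtree par w₂) := by
    rw [Finset.disjoint_left]
    intro x hx₁ hx₂
    obtain ⟨a, ha⟩ := mem_subtree.mp hx₁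
    obtain ⟨b, hb⟩ := mem_subtree.mp hx₂
    rcases le_total a b with hab | hab
    · exact hne (key h₁ h₂ hab ha hb)
    · exact hne (key h₂ h₁ hab hb ha).symm
  have hcard : (subtree par w₁).card + (subtree par w₂).card ≤ (subtree par v).card := by
    rw [← Finset.card_union_of_disjoint hdisj]
    exact Finset.card_le_card (Finset.union_subset (subtree_subset h₁) (subtree_subset h₂))
  have pos : ∀ w, (subtree par w).card ≠ 0 := fun w =>
    (Finset.card_pos.mpr ⟨w, self_mem_subtree w⟩).ne'
  have e₁ := Nat.pow_log_le_self 2 (pos w₁)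
  have e₂ := Nat.pow_log_le_self 2 (pos w₂)
  have e₃ := Nat.lt_pow_succ_log_self (b := 2) (by norm_num) (subtree par v).card
  unfold rank at r₁ r₂
  rw [r₁] at e₁
  rw [r₂] at e₂
  rw [pow_succ] at e₃
  omega

end Potential

open Classical in
/-- The descendant `2 ^ k` levels below `v` that has the same rank as `v`, if it exists. -/
noncomputable def jump (par : V → Option V) (k : ℕ) (v : V) : Option V :=
  if h : ∃ w, up par (2 ^ k) w = some v ∧ rank par w = rank par v then some h.choose else none

section Potential

variable {δ : V → ℕ} (hδ : ∀ w v, par w = some v → δ v < δ w)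

include hδ

/-- The choice in `jump` is harmless because the target is unique. -/
lemma jump_eq {k : ℕ} {v w : V} (h : up par (2 ^ k) w = some v)
    (hr : rank par w = rank par v) : jump par k v = some w := by
  have hex : ∃ w, up par (2 ^ k) w = some v ∧ rank par w = rank par v := ⟨w, h, hr⟩
  rw [jump, dif_pos hex]
  exact congrArg some
    (eq_of_up_of_rank_eq hδ hex.choose_spec.1 h hex.choose_spec.2 hr)

/-- Climbing as long as the rank does not change. -/
lemma exists_up_rank_eq (w : V) :
    ∃ v j, up par j w = some v ∧ rank par w = rank par v ∧
      (par v = none ∨ ∃ z, par v = some z ∧ rank par v < rank par z) := by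
  induction hd : δ w using Nat.strong_induction_on generalizing w with
  | _ d ih =>
    cases hp : par w with
    | none => exact ⟨w, 0, rfl, rfl, Or.inl hp⟩
    | some z =>
      have hz : up par 1 w = some z := by rw [up_one, hp]
      rcases (rank_le_rank hz).lt_or_eq with hlt | heq
      · exact ⟨w, 0, rfl, rfl, Or.inr ⟨z, hp, hlt⟩⟩
      · obtain ⟨v, j, h1, h2, h3⟩ := ih (δ z) (hd ▸ hδ w z hp) z rfl
        exact ⟨v, j + 1, by rw [up_succ hp, h1], heq.trans h2, h3⟩

end Potential

/-- The nodes of the part `good` of a tree that are informed after `r` rounds and the first `k` steps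
of the next round, if initially the root is informed and a round consists of messages to children
and then messages along jumps of lengths `2 ^ 0, …, 2 ^ (K - 1)`. -/
inductive Spreads (par : V → Option V) (good : V → Prop) (K : ℕ) : ℕ → ℕ → V → Prop
  | root {w : V} : good w → par w = none → Spreads par good K 0 0 w
  | start {r : ℕ} {v : V} : Spreads par good K r 0 v → Spreads par good K r 1 v
  | child {r : ℕ} {v w : V} : good w → par w = some v → Spreads par good K r 0 v →
      Spreads par good K r 1 w
  | stay {r k : ℕ} {v : V} : Spreads par good K r (k + 1) v → Spreads par good K r (k + 2) v
  | jump {r k : ℕ} {v w : V} : good w → jump par k v = some w →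
      Spreads par good K r (k + 1) v → Spreads par good K r (k + 2) w
  | next {r : ℕ} {v : V} : Spreads par good K r (K + 1) v → Spreads par good K (r + 1) 0 v

namespace Spreads

variable {good : V → Prop} {K : ℕ}

lemma finish {r : ℕ} {v : V} (h0 : Spreads par good K r 0 v) : Spreads par good K (r + 1) 0 v := by
  have : ∀ k, Spreads par good K r (k + 1) v := by
    intro k
    induction k with
    | zero => exact h0.start
    | succ k ih => exact ih.stay
  exact (this K).next

lemma isGood {r k : ℕ} {v : V} (h : Spreads par good K r k v) : good v := by
  induction h <;> assumption

variable (closed : ∀ w v, good w → par w = some v → good v)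
include closed

variable {δ : V → ℕ} (hδ : ∀ w v, par w = some v → δ v < δ w)
include hδ

/-- The binary expansion of `j` is used with increasing jump lengths. The intermediate node has the
same rank since ranks are monotone along the path. -/
lemma along {r k j : ℕ} {v w : V} (hw : good w) (hv : Spreads par good K r 1 v)
    (hj : up par j w = some v) (hr : rank par w = rank par v) (hjk : j < 2 ^ k) :
    Spreads par good K r (k + 1) w := by
  induction k generalizing j w with
  | zero =>
    obtain rfl : j = 0 := by simpa using hjk
    simp at hj
    exact hj ▸ hv
  | succ k ih =>
    rcases lt_or_ge j (2 ^ k) with hlt | hge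
    · exact (ih hw hj hr hlt).stay
    · obtain ⟨z, hz, hz'⟩ := exists_up_of_le hge hj
      have r1 := rank_le_rank hz
      have r2 := rank_le_rank hz'
      refine .jump hw (jump_eq hδ hz (by omega))
        (ih (of_up_of_closed closed hw hz) hz' (by omega) ?_)
      rw [pow_succ] at hjk
      omega

/-- After `r` rounds all good nodes of rank above `R - r` are informed. From `w` climb to the top
`v` of its path of constant rank: the parent of `v` has larger rank and is informed by induction, it
informs its child `v`, and jumps lead from `v` to `w`. -/
lemma reach (hK : Fintype.card V ≤ 2 ^ K) {R : ℕ} (hR : ∀ v, rank par v ≤ R) {r : ℕ} {w : V}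
    (hw : good w) (hr : R < rank par w + r) : Spreads par good K r 0 w := by
  induction r generalizing w with
  | zero => have := hR w; omega
  | succ r ih =>
    obtain ⟨v, j, hv, hrank, htop⟩ := exists_up_rank_eq hδ w
    have gv := of_up_of_closed closed hw hv
    refine (along closed hδ hw ?_ hv hrank ((lt_card_of_up hδ hv).trans_le hK)).next
    rcases htop with hnone | ⟨z, hz, hlt⟩
    · refine .start ?_
      clear hr ih
      induction r with
      | zero => exact .root gv hnone
      | succ r ih => exact ih.finish
    · exact .child gv hz (ih (closed v z gv hz) (by omega))

end Spreads

end Forest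

/-! ### Scaled distances -/

section Distances

variable {n : ℕ}

/-- `Reach e u v h a`: in the digraph with edge weights `e` there is a walk from `u` to `v` with `h`
edges and weight `a`. -/
inductive Reach (e : Fin n → Fin n → Option ℕ) (u : Fin n) : Fin n → ℕ → ℕ → Prop
  | nil : Reach e u u 0 0
  | snoc {v w : Fin n} {h a c : ℕ} : Reach e u v h a → e v w = some c → Reach e u w (h + 1) (a + c)

/-- There is a walk from `u` to `v` of scaled weight `z`, where an edge of weight `c` has the scaled
weight `n * c + 1`. -/
def HasCost (e : Fin n → Fin n → Option ℕ) (u v : Fin n) (z : ℕ) : Prop :=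
  ∃ h a, Reach e u v h a ∧ z = n * a + h

variable {e e' : Fin n → Fin n → Option ℕ} {u v w : Fin n}

lemma Reach.mono (hee : ∀ a b c, e a b = some c → e' a b = some c) {h a : ℕ}
    (hr : Reach e u v h a) : Reach e' u v h a := by
  induction hr with
  | nil => exact .nil
  | snoc _ hc ih => exact ih.snoc (hee _ _ _ hc)

lemma Reach.trans {h a h' a' : ℕ} (hr : Reach e u v h a) (hr' : Reach e v w h' a') :
    Reach e u w (h + h') (a + a') := by
  induction hr' with
  | nil => exact hr
  | snoc _ hc ih =>
    rw [← Nat.add_assoc, ← Nat.add_assoc]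
    exact ih.snoc hc

lemma Reach.split {h a : ℕ} (hr : Reach e u w h a) {i : ℕ} (hi : i ≤ h) :
    ∃ p a₁ a₂, Reach e u p i a₁ ∧ Reach e p w (h - i) a₂ ∧ a₁ + a₂ = a := by
  induction hr with
  | nil =>
    obtain rfl : i = 0 := by omega
    exact ⟨u, 0, 0, .nil, .nil, rfl⟩
  | @snoc v w h a c hr hc ih =>
    rcases Nat.lt_or_ge h i with hlt | hge
    · obtain rfl : i = h + 1 := by omega
      exact ⟨w, a + c, 0, hr.snoc hc, by rw [Nat.sub_self]; exact .nil, rfl⟩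
    · obtain ⟨p, a₁, a₂, h1, h2, h3⟩ := ih hge
      refine ⟨p, a₁, a₂ + c, h1, ?_, by omega⟩
      rw [Nat.succ_sub hge]
      exact h2.snoc hc

lemma HasCost.mono (hee : ∀ a b c, e a b = some c → e' a b = some c) {z : ℕ}
    (hr : HasCost e u v z) : HasCost e' u v z := by
  obtain ⟨h, a, hr, rfl⟩ := hr
  exact ⟨h, a, hr.mono hee, rfl⟩

lemma HasCost.refl : HasCost e u u 0 := ⟨0, 0, .nil, rfl⟩

lemma HasCost.trans {z z' : ℕ} (hr : HasCost e u v z) (hr' : HasCost e v w z') :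
    HasCost e u w (z + z') := by
  obtain ⟨h, a, hr, rfl⟩ := hr
  obtain ⟨h', a', hr', rfl⟩ := hr'
  exact ⟨_, _, hr.trans hr', by ring⟩

lemma HasCost.edge {c : ℕ} (hc : e u v = some c) : HasCost e u v (n * c + 1) :=
  ⟨1, 0 + c, Reach.nil.snoc hc, by ring⟩

open Classical in
/-- The least scaled weight of a walk from `u` to `v`. -/
noncomputable def scaledDist (e : Fin n → Fin n → Option ℕ) (u v : Fin n) : Option ℕ :=
  if h : ∃ z, HasCost e u v z then some (Nat.find h) else none

lemma HasCost.scaledDist_le {z : ℕ} (hz : HasCost e u v z) :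
    ∃ d, scaledDist e u v = some d ∧ d ≤ z := by
  classical
  have h : ∃ z, HasCost e u v z := ⟨z, hz⟩
  exact ⟨Nat.find h, by simp [scaledDist, h], Nat.find_min' h hz⟩

lemma hasCost_of_scaledDist {d : ℕ} (hd : scaledDist e u v = some d) : HasCost e u v d := by
  classical
  unfold scaledDist at hd
  split_ifs at hd with h
  rw [← Option.some.inj hd]
  exact Nat.find_spec h

lemma le_of_scaledDist {d z : ℕ} (hd : scaledDist e u v = some d) (hz : HasCost e u v z) :
    d ≤ z := by
  obtain ⟨d', h, hle⟩ := hz.scaledDist_le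
  rw [hd] at h
  exact (Option.some.inj h) ▸ hle

lemma scaledDist_self : scaledDist e u u = some 0 := by
  obtain ⟨d, hd, hle⟩ := (HasCost.refl (e := e) (u := u)).scaledDist_le
  rwa [Nat.le_zero.mp hle] at hd

/-- `v` precedes `w` on a shortest walk from `u`. -/
def Precedes (e : Fin n → Fin n → Option ℕ) (u w v : Fin n) : Prop :=
  ∃ d c, scaledDist e u v = some d ∧ e v w = some c ∧ scaledDist e u w = some (d + (n * c + 1))

lemma exists_precedes {d : ℕ} (hd : scaledDist e u w = some d) (hw : w ≠ u) :
    ∃ v, Precedes e u w v := by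
  obtain ⟨h, a, hr, hz⟩ := hasCost_of_scaledDist hd
  cases hr with
  | nil => exact absurd rfl hw
  | @snoc v _ h a c hr hc =>
    obtain ⟨d', hd', hle⟩ := (show HasCost e u v (n * a + h) from ⟨h, a, hr, rfl⟩).scaledDist_le
    refine ⟨v, d', c, hd', hc, ?_⟩
    have := le_of_scaledDist hd ((hasCost_of_scaledDist hd').trans (HasCost.edge hc))
    rw [hd]
    congr 1
    rw [Nat.mul_add] at hz
    omega

open Classical in
/-- The parent function of a shortest-path tree with root `u`. -/
noncomputable def parent (e : Fin n → Fin n → Option ℕ) (u w : Fin n) : Option (Fin n) :=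
  if h : w ≠ u ∧ ∃ v, Precedes e u w v then some h.2.choose else none

lemma precedes_of_parent (h : parent e u w = some v) : Precedes e u w v := by
  unfold parent at h
  split_ifs at h with hex
  rw [← Option.some.inj h]
  exact hex.2.choose_spec

lemma eq_of_parent_eq_none {d : ℕ} (hd : scaledDist e u w = some d) (h : parent e u w = none) :
    w = u := by
  by_contra hw
  unfold parent at h
  rw [dif_pos ⟨hw, exists_precedes hd hw⟩] at h
  cases h

/-- The potential that makes `parent` a forest. The default `0` plays no role, since both distances
exist when there is a parent. -/
lemma getD_scaledDist_lt (w v : Fin n) (h : parent e u w = some v) :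
    (scaledDist e u v).getD 0 < (scaledDist e u w).getD 0 := by
  obtain ⟨d, c, h1, _, h2⟩ := precedes_of_parent h
  simp [h1, h2]

end Distances

/-! ### Distances in the network -/

namespace WeightedGraph

variable {n : ℕ} (G : WeightedGraph n)

open Classical in
/-- The edge weights of the graph, as the nodes know them. -/
noncomputable def edges (u v : Fin n) : Option ℕ :=
  if G.graph.Adj u v then some (G.weight s(u, v)) else none

variable {G} {u v s : Fin n}

lemma edges_eq_some {c : ℕ} :
    G.edges u v = some c ↔ G.graph.Adj u v ∧ c = G.weight s(u, v) := by
  simp only [edges]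
  split_ifs with h <;> simp [h, eq_comm]

lemma edges_symm : G.edges u v = G.edges v u := by
  by_cases h : G.graph.Adj u v
  · simp [edges, h, h.symm, Sym2.eq_swap]
  · simp [edges, h, show ¬ G.graph.Adj v u from fun h' => h h'.symm]

/-- Walks grow at the front and `Reach` grows at the end, so the direction is reversed; the graph is
undirected. -/
lemma reach_of_walk (p : G.graph.Walk v s) :
    Reach G.edges s v p.length (p.edges.map G.weight).sum := by
  induction p with
  | nil => exact .nil
  | @cons u v s h p ih =>
    rw [SimpleGraph.Walk.length_cons, SimpleGraph.Walk.edges_cons, List.map_cons, List.sum_cons,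
      Nat.add_comm (G.weight _)]
    exact ih.snoc (edges_eq_some.mpr ⟨h.symm, by rw [Sym2.eq_swap]⟩)

lemma exists_walk_of_reach {h a : ℕ} (hr : Reach G.edges s v h a) :
    ∃ p : G.graph.Walk v s, p.length = h ∧ (p.edges.map G.weight).sum = a := by
  induction hr with
  | nil => exact ⟨.nil, rfl, rfl⟩
  | snoc _ hc ih =>
    obtain ⟨p, rfl, rfl⟩ := ih
    obtain ⟨hadj, rfl⟩ := edges_eq_some.mp hc
    exact ⟨.cons hadj.symm p, rfl, by simp [Sym2.eq_swap, Nat.add_comm]⟩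

lemma dist_le_of_reach {h a : ℕ} (hr : Reach G.edges s v h a) : G.dist v s ≤ a := by
  classical
  obtain ⟨p, -, rfl⟩ := exists_walk_of_reach hr
  refine (iInf_le _ p.toPath).trans ?_
  have hsub := List.subperm_of_subset p.toPath.2.1.edges_nodup (p.edges_bypass_subset_edges)
  obtain ⟨l, hl, hl'⟩ := hsub
  rw [Nat.cast_le]
  calc G.pathWeight p.toPath = (l.map G.weight).sum := ((hl.map G.weight).sum_eq).symm
    _ ≤ (p.edges.map G.weight).sum := (hl'.map G.weight).sum_le_sum (by simp)

lemma spd_spec (u v : Fin n) : G.hopDist G.spd u v = G.dist u v := by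
  have hne : {h : ℕ | ∀ u v, G.hopDist h u v = G.dist u v}.Nonempty := by
    refine ⟨n, fun u v => le_antisymm (le_iInf fun p => ?_) (le_iInf fun p => iInf_le _ p.1)⟩
    have := p.2.length_lt
    rw [Fintype.card_fin] at this
    exact iInf_le (fun p : {p : G.graph.Path u v // p.1.length ≤ n} => (G.pathWeight p.1 : ℕ∞))
      ⟨p, this.le⟩
  exact Nat.sInf_mem hne u v

lemma exists_reach_of_dist_ne_top (h : G.dist v s ≠ ⊤) :
    ∃ k a, Reach G.edges s v k a ∧ G.dist v s = a ∧ k ≤ G.spd ∧ k < n ∧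
      ∀ b, (∀ e ∈ G.graph.edgeSet, G.weight e ≤ b) → a ≤ k * b := by
  rw [← spd_spec, hopDist] at h
  have : Nonempty {p : G.graph.Path v s // p.1.length ≤ G.spd} := by
    by_contra hemp
    rw [not_nonempty_iff] at hemp
    exact h (iInf_of_empty _)
  obtain ⟨p, hp⟩ := ciInf_mem
    fun p : {p : G.graph.Path v s // p.1.length ≤ G.spd} => (G.pathWeight p.1 : ℕ∞)
  refine ⟨_, _, reach_of_walk p.1.1, ?_, p.2, ?_, fun b hb => ?_⟩
  · rw [← spd_spec]; exact hp.symm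
  · simpa using p.1.2.length_lt
  · rw [← SimpleGraph.Walk.length_edges, ← List.length_map (f := G.weight), ← smul_eq_mul]
    refine List.sum_le_card_nsmul _ _ fun x hx => ?_
    obtain ⟨e, he, rfl⟩ := List.mem_map.mp hx
    exact hb e (SimpleGraph.Walk.edges_subset_edgeSet _ he)

lemma dist_eq_top_of_scaledDist (h : scaledDist G.edges s v = none) : G.dist v s = ⊤ := by
  by_contra htop
  obtain ⟨k, a, hr, -⟩ := exists_reach_of_dist_ne_top htop
  obtain ⟨d, hd, -⟩ := (show HasCost G.edges s v (n * a + k) from ⟨k, a, hr, rfl⟩).scaledDist_le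
  rw [hd] at h
  cases h

/-- A scaled distance consists of the distance and the least number of edges of a shortest path. -/
lemma scaledDist_spec {d : ℕ} (hd : scaledDist G.edges s v = some d) :
    Reach G.edges s v (d % n) (d / n) ∧ G.dist v s = (d / n : ℕ) ∧ d % n ≤ G.spd ∧
      ∀ b, (∀ e ∈ G.graph.edgeSet, G.weight e ≤ b) → d / n ≤ n * b := by
  obtain ⟨h, a, hr, rfl⟩ := hasCost_of_scaledDist hd
  have hle := dist_le_of_reach hr
  obtain ⟨k, a', hr', hdist, hk, hkn, hb⟩ :=
    exists_reach_of_dist_ne_top (ne_top_of_le_ne_top (ENat.natCast_ne_top a) hle)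
  rw [hdist, Nat.cast_le] at hle
  have h2 := le_of_scaledDist hd ⟨k, a', hr', rfl⟩
  -- One unit of weight counts `n` in the scaled cost, more than the `k < n` edges of a shortest
  -- path can make up for.
  have h3 : a = a' := by
    by_contra hne
    have : a' + 1 ≤ a := by omega
    have := Nat.mul_le_mul_left n this
    rw [Nat.mul_add] at this
    omega
  subst h3
  have hn : h < n := by omega
  have e1 : (n * a + h) / n = a := by
    rw [Nat.mul_add_div (by omega), Nat.div_eq_of_lt hn, Nat.add_zero]
  have e2 : (n * a + h) % n = h := by rw [Nat.mul_add_mod, Nat.mod_eq_of_lt hn]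
  rw [e1, e2]
  refine ⟨hr, hdist, by omega, fun b hb' => (hb b hb').trans (Nat.mul_le_mul_right b hkn.le)⟩

/-- Scaled distances are polynomial in `n`, so a proposal fits into one global message. -/
lemma scaledDist_lt {q d : ℕ} (hn : 2 ≤ n) (hw : ∀ e ∈ G.graph.edgeSet, G.weight e ≤ n ^ q)
    (hd : scaledDist G.edges s v = some d) : d < n ^ (q + 3) := by
  obtain ⟨-, -, -, hb⟩ := scaledDist_spec hd
  have h1 := hb _ hw
  have h2 := Nat.div_add_mod d n
  have h3 := Nat.mod_lt d (show n > 0 by omega)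
  have h4 : n * (d / n) ≤ n * (n * n ^ q) := Nat.mul_le_mul_left n h1
  have h5 : n * (n * n ^ q) + n ≤ 2 * (n * (n * n ^ q)) := by
    have : 0 < n ^ q := by positivity
    nlinarith [Nat.mul_le_mul_left n (show 1 ≤ n * n ^ q by nlinarith)]
  have h6 : 2 * (n * (n * n ^ q)) ≤ n * (n * (n * n ^ q)) := Nat.mul_le_mul_right _ hn
  have h7 : n ^ (q + 3) = n * (n * (n * n ^ q)) := by ring
  omega

/-- The numbers of edges of shortest paths add up. -/
lemma mod_add_of_shortest {p w : Fin n} {d d' h a : ℕ} (hd : scaledDist G.edges s p = some d)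
    (hd' : scaledDist G.edges s w = some d') (hr : Reach G.edges p w h a)
    (hsum : d + (n * a + h) = d') : d' % n = d % n + h := by
  have hn : 0 < n := p.pos
  obtain ⟨h1, -, -, -⟩ := scaledDist_spec hd
  obtain ⟨-, h2, -, -⟩ := scaledDist_spec hd'
  have h3 := dist_le_of_reach (h1.trans hr)
  rw [h2, Nat.cast_le] at h3
  have h4 := Nat.div_add_mod d n
  have h5 := Nat.div_add_mod d' n
  have h6 := Nat.mod_lt d' hn
  -- The hop counts add without a carry: a smaller quotient would force `d'` below `n * (d / n +
  -- a)`.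
  have h7 : d' / n = d / n + a := by
    by_contra hne
    have : d' / n + 1 ≤ d / n + a := by omega
    have := Nat.mul_le_mul_left n this
    rw [Nat.mul_add, Nat.mul_add] at this
    omega
  rw [h7, Nat.mul_add] at h5
  omega

/-- `v` is at most `r` edges away from `u`. -/
def Near (G : WeightedGraph n) (r : ℕ) (u v : Fin n) : Prop :=
  ∃ p : G.graph.Walk u v, p.length ≤ r

lemma Near.symm {r : ℕ} (h : G.Near r u v) : G.Near r v u := by
  obtain ⟨p, hp⟩ := h
  exact ⟨p.reverse, by simpa using hp⟩

lemma near_self (r : ℕ) : G.Near r u u := ⟨.nil, Nat.zero_le _⟩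

lemma Near.mono {r r' : ℕ} (h : G.Near r u v) (hr : r ≤ r') : G.Near r' u v := by
  obtain ⟨p, hp⟩ := h
  exact ⟨p, hp.trans hr⟩

lemma near_zero : G.Near 0 u v ↔ u = v := by
  constructor
  · rintro ⟨p, hp⟩
    exact SimpleGraph.Walk.eq_of_length_eq_zero (Nat.le_zero.mp hp)
  · rintro rfl
    exact near_self 0

lemma near_succ {r : ℕ} :
    G.Near (r + 1) u v ↔ G.Near r u v ∨ ∃ z, G.graph.Adj u z ∧ G.Near r z v := by
  constructor
  · rintro ⟨p, hp⟩
    cases p with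
    | nil => exact Or.inl (near_self r)
    | cons h p => exact Or.inr ⟨_, h, p, by simpa using hp⟩
  · rintro (h | ⟨z, hz, p, hp⟩)
    · exact h.mono (Nat.le_succ r)
    · exact ⟨.cons hz p, by simpa using hp⟩

lemma near_of_reach {h a : ℕ} (hr : Reach G.edges u v h a) : G.Near h u v := by
  obtain ⟨p, hp, -⟩ := exists_walk_of_reach hr
  exact Near.symm ⟨p, hp.le⟩

end WeightedGraph

/-! ### Balls of radius `t` and the distances inside them. -/

/-- The incident edges of some of the nodes. -/
abbrev Table (n : ℕ) : Type := Fin n → Option (Fin n → Option ℕ)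

/-- The edges between nodes whose incident edges are all known. -/
def Table.edges {n : ℕ} (K : Table n) (u v : Fin n) : Option ℕ :=
  (K u).bind fun r => if (K v).isSome then r v else none

namespace WeightedGraph

variable {n : ℕ} (G : WeightedGraph n)

open Classical in
/-- The incident edges of the nodes that are at most `t` edges away from `u`. -/
noncomputable def ball (t : ℕ) (u : Fin n) : Table n :=
  fun v => if G.Near t u v then some (G.edges v) else none

variable {G} {t : ℕ} {u v w s : Fin n}

lemma ball_edges_eq_some {c : ℕ} : (G.ball t u).edges v w = some c ↔
    G.Near t u v ∧ G.Near t u w ∧ G.edges v w = some c := by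
  unfold Table.edges ball
  by_cases hv : G.Near t u v <;> by_cases hw : G.Near t u w <;> simp [hv, hw]

lemma edges_of_ball (v w : Fin n) (c : ℕ) (h : (G.ball t u).edges v w = some c) :
    G.edges v w = some c :=
  (ball_edges_eq_some.mp h).2.2

/-- All nodes on a walk of at most `t` edges from `u` are in the ball, so short shortest walks
survive the restriction. -/
lemma reach_ball {h a : ℕ} (hr : Reach G.edges u v h a) (ht : h ≤ t) :
    Reach (G.ball t u).edges u v h a := by
  induction hr with
  | nil => exact .nil
  | snoc hr hc ih =>
    exact (ih (by omega)).snoc (ball_edges_eq_some.mpr ⟨(near_of_reach hr).mono (by omega),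
      (near_of_reach (hr.snoc hc)).mono ht, hc⟩)

lemma near_of_ball_dist {d : ℕ} (h : scaledDist (G.ball t u).edges u v = some d) :
    G.Near t u v := by
  obtain ⟨k, a, hr, -⟩ := hasCost_of_scaledDist h
  cases hr with
  | nil => exact near_self t
  | snoc _ hc => exact (ball_edges_eq_some.mp hc).2.1

lemma hasCost_of_ball_dist {d : ℕ} (h : scaledDist (G.ball t u).edges u v = some d) :
    HasCost G.edges u v d :=
  (hasCost_of_scaledDist h).mono edges_of_ball

end WeightedGraph

/-! ### The best proposals -/

/-- A proposal `(a, u)`: the scaled distance is at most `a`, by a walk via `u`. -/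
abbrev Proposal (n M : ℕ) : Type := Fin M ×ₗ Fin n

/-- The proposal `(a, u)`, if the number `a` is not too large. -/
def propose {n : ℕ} (M a : ℕ) (u : Fin n) : WithTop (Proposal n M) :=
  if h : a < M then ((toLex (⟨a, h⟩, u) : Proposal n M) : WithTop (Proposal n M)) else ⊤

section Proposals

variable {n M : ℕ} {a a' : ℕ} {u u' : Fin n}

lemma propose_of_lt (h : a < M) : propose M a u = ((toLex (⟨a, h⟩, u) : Proposal n M) :) := by
  simp [propose, h]

lemma propose_eq_coe {z : Proposal n M} :
    propose M a u = z ↔ a = ((ofLex z).1 : ℕ) ∧ u = (ofLex z).2 := by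
  unfold propose
  split_ifs with h
  · rw [WithTop.coe_inj]
    constructor
    · rintro rfl; simp
    · rintro ⟨h1, h2⟩
      apply ofLex.injective
      ext <;> simp [h1, h2]
  · simp only [WithTop.top_ne_coe, false_iff]
    rintro ⟨h1, -⟩
    exact h (h1 ▸ (ofLex z).1.2)

lemma propose_le_propose (ha : a < M) :
    propose M a u ≤ propose M a' u' ↔ M ≤ a' ∨ a < a' ∨ a = a' ∧ u ≤ u' := by
  rw [propose_of_lt ha]
  unfold propose
  split_ifs with h
  · rw [WithTop.coe_le_coe, Prod.Lex.toLex_le_toLex]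
    simp [Fin.ext_iff, Fin.lt_def, h]
  · simp; omega

end Proposals

section Best

variable {n : ℕ} (M : ℕ) (G : WeightedGraph n) (s : Fin n) (t l : ℕ) (x : Fin n → Option ℕ)

/-- The proposal for `v` by the root `u`, if `x u` has the hop number `l`. -/
noncomputable def candidate (u v : Fin n) : WithTop (Proposal n M) :=
  match x u, scaledDist (G.ball t u).edges u v with
  | some a, some d => if a % n = l then propose M (a + d) u else ⊤
  | _, _ => ⊤

/-- The best proposal for `v`. -/
noncomputable def best (v : Fin n) : WithTop (Proposal n M) :=
  Finset.univ.inf fun u => candidate M G t l x u v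

variable {M G s t l x} {u v w : Fin n}

lemma candidate_eq_coe {z : Proposal n M} : candidate M G t l x u v = z ↔
    ∃ a d, x u = some a ∧ scaledDist (G.ball t u).edges u v = some d ∧ a % n = l ∧
      a + d = ((ofLex z).1 : ℕ) ∧ u = (ofLex z).2 := by
  unfold candidate
  cases hx : x u <;> cases hd : scaledDist (G.ball t u).edges u v
  · simp
  · simp
  · simp
  · dsimp only
    split_ifs with h
    · simp [propose_eq_coe, h]
    · simp [h]

lemma candidate_eq {a d : ℕ} (hx : x u = some a)
    (hd : scaledDist (G.ball t u).edges u v = some d) (hl : a % n = l) :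
    candidate M G t l x u v = propose M (a + d) u := by
  simp [candidate, hx, hd, hl]

lemma best_le : best M G t l x v ≤ candidate M G t l x u v :=
  Finset.inf_le (Finset.mem_univ u)

variable (M G s t l x) in
/-- The root `u` provides the best proposal for `w`, which is the exact distance, and the hop number
of `w` is in the right range. -/
def Served (u w : Fin n) : Prop :=
  ∃ d, scaledDist G.edges s w = some d ∧ l ≤ d % n ∧ d % n ≤ l + t ∧ d < M ∧
    candidate M G t l x u w = propose M d u ∧ best M G t l x w = propose M d u

variable (M G s l x) in
/-- Upper bounds on the scaled distances that are exact up to the hop number `l`. -/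
structure Bounds : Prop where
  sound : ∀ v a, x v = some a → HasCost G.edges s v a
  exact : ∀ v d, scaledDist G.edges s v = some d → d % n ≤ l → x v = some d
  small : ∀ v d, scaledDist G.edges s v = some d → d < M

namespace Bounds

variable (h : Bounds M G s l x)
include h

/-- The bound of `u` and the distance in the ball are costs of actual walks. If their sum does not
exceed the exact distance, then all inequalities are tight; in particular the bound of `u` is exact.
-/
lemma exact_of_candidate {d : ℕ} {z : Proposal n M} (hd : scaledDist G.edges s w = some d)
    (hz : candidate M G t l x u w = z) (hle : ((ofLex z).1 : ℕ) ≤ d) :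
    ∃ a b k c, scaledDist G.edges s u = some a ∧ x u = some a ∧ a % n = l ∧
      scaledDist (G.ball t u).edges u w = some b ∧ a + b = d ∧ ((ofLex z).1 : ℕ) = d ∧
      Reach G.edges u w k c ∧ b = n * c + k := by
  obtain ⟨a, b, hx, hb, hl, hab, hu⟩ := candidate_eq_coe.mp hz
  have h1 := h.sound u a hx
  have h2 := WeightedGraph.hasCost_of_ball_dist hb
  have h3 := le_of_scaledDist hd (h1.trans h2)
  obtain ⟨a', ha', hle'⟩ := h1.scaledDist_le
  have h4 := le_of_scaledDist hd ((hasCost_of_scaledDist ha').trans h2)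
  obtain rfl : a' = a := by omega
  obtain ⟨k, c, hr, hb'⟩ := h2
  exact ⟨a', b, k, c, ha', hx, hl, hb, by omega, by omega, hr, hb'⟩

/-- Once some root proposes the exact value, no proposal is smaller, and the minimum only selects
the least such root. -/
lemma exists_best {d : ℕ} (hd : scaledDist G.edges s w = some d) {p : Fin n}
    (hp : candidate M G t l x p w = propose M d p) :
    ∃ u ≤ p, candidate M G t l x u w = propose M d u ∧ best M G t l x w = propose M d u := by
  have hM := h.small w d hd
  have : (Finset.univ : Finset (Fin n)).Nonempty := ⟨w, Finset.mem_univ w⟩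
  obtain ⟨u, -, hu⟩ := Finset.exists_mem_eq_inf _ this fun u => candidate M G t l x u w
  have hle : candidate M G t l x u w ≤ propose M d p := by
    rw [← hu, ← hp]; exact best_le
  have hne : candidate M G t l x u w ≠ ⊤ := by
    intro htop
    rw [htop, propose_of_lt hM, top_le_iff] at hle
    cases hle
  obtain ⟨z, hz⟩ := WithTop.ne_top_iff_exists.mp hne
  obtain ⟨a, b, hx, hb, hl, hab, hu'⟩ := candidate_eq_coe.mp hz.symm
  have hz' : propose M (a + b) u = z := propose_eq_coe.mpr ⟨hab, hu'⟩
  have hlt : a + b < M := hab ▸ (ofLex z).1.2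
  rw [← hz, ← hz', propose_le_propose hlt] at hle
  have hle' : ((ofLex z).1 : ℕ) ≤ d := by omega
  obtain ⟨_, _, _, _, -, -, -, -, -, hzd, -, -⟩ := h.exact_of_candidate hd hz.symm hle'
  have : a + b = d := by omega
  rw [this] at hz'
  exact ⟨u, by omega, by rw [← hz, hz'], by rw [best, hu, ← hz, hz']⟩

lemma exists_served {d : ℕ} (hd : scaledDist G.edges s w = some d) (hl : l ≤ d % n)
    (ht : d % n ≤ l + t) : ∃ u, Served M G s t l x u w := by
  have hn : 0 < n := w.pos
  obtain ⟨hr, -⟩ := WeightedGraph.scaledDist_spec hd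
  -- Cut a shortest walk after `l` edges: `p` has hop number exactly `l`, hence an exact bound, and
  -- the remaining at most `t` edges lie in its ball.
  obtain ⟨p, a₁, a₂, hr₁, hr₂, ha⟩ := hr.split hl
  obtain ⟨dp, hdp, hle⟩ := (show HasCost G.edges s p (n * a₁ + l) from ⟨_, _, hr₁, rfl⟩).scaledDist_le
  have hz : HasCost G.edges p w (n * a₂ + (d % n - l)) := ⟨_, _, hr₂, rfl⟩
  have h1 := le_of_scaledDist hd ((hasCost_of_scaledDist hdp).trans hz)
  have hdiv := Nat.div_add_mod d n
  rw [← ha, Nat.mul_add] at hdiv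
  have h2 : dp = n * a₁ + l := by omega
  have hmod : dp % n = l := by
    rw [h2, Nat.mul_add_mod, Nat.mod_eq_of_lt (hl.trans_lt (Nat.mod_lt d hn))]
  have hx := h.exact p dp hdp hmod.le
  obtain ⟨b, hb, hble⟩ := (show HasCost (G.ball t p).edges p w (n * a₂ + (d % n - l)) from
    ⟨_, _, WeightedGraph.reach_ball hr₂ (by omega), rfl⟩).scaledDist_le
  have h3 := le_of_scaledDist hd
    ((hasCost_of_scaledDist hdp).trans (WeightedGraph.hasCost_of_ball_dist hb))
  have hc := candidate_eq (M := M) hx hb hmod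
  rw [show dp + b = d by omega] at hc
  obtain ⟨u, -, hu1, hu2⟩ := h.exists_best hd hc
  exact ⟨u, d, hd, hl, ht, h.small w d hd, hu1, hu2⟩

/-- The key property of the tie-breaking. The best root `u'` for the parent `v` satisfies `u' ≤ u`.
Extending its walk by the edge to `w` gives an exact proposal for `w` as well, so optimality of `u`
for `w` yields `u ≤ u'`. -/
lemma served_parent (hw : Served M G s t l x u w)
    (hp : parent (G.ball t u).edges u w = some v) : Served M G s t l x u v := by
  obtain ⟨d, hd, hl, ht, hM, hc, hbest⟩ := hw
  rw [propose_of_lt hM] at hc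
  obtain ⟨a, b, k, c, ha, hx, hal, hb, hab, -, -, -⟩ := h.exact_of_candidate hd hc le_rfl
  obtain ⟨b', c', hb', hc', hbw⟩ := precedes_of_parent hp
  rw [hb, Option.some.injEq] at hbw
  have hcG := WeightedGraph.edges_of_ball _ _ _ hc'
  have hedge := HasCost.edge hcG
  have hcost := WeightedGraph.hasCost_of_ball_dist hb'
  obtain ⟨dv, hdv, hdvle⟩ := ((hasCost_of_scaledDist ha).trans hcost).scaledDist_le
  have h1 := le_of_scaledDist hd ((hasCost_of_scaledDist hdv).trans hedge)
  have hdv' : dv = a + b' := by omega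
  have hmod1 := WeightedGraph.mod_add_of_shortest hdv hd (Reach.nil.snoc hcG)
    (by rw [Nat.zero_add]; omega)
  obtain ⟨k', c'', hr', hbk⟩ := hcost
  have hmod2 := WeightedGraph.mod_add_of_shortest ha hdv hr' (by omega)
  have hcv := candidate_eq (M := M) hx hb' hal
  rw [← hdv'] at hcv
  obtain ⟨u', hu', hc1, hc2⟩ := h.exists_best hdv hcv
  have hMv := h.small v dv hdv
  suffices u' = u by
    subst this
    exact ⟨dv, hdv, by omega, by omega, hMv, hc1, hc2⟩
  rw [propose_of_lt hMv] at hc1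
  obtain ⟨a₁, b₁, k₁, c₁, ha₁, hx₁, hal₁, hb₁, hab₁, -, hr₁, hbk₁⟩ :=
    h.exact_of_candidate hdv hc1 le_rfl
  have hr₂ := hr₁.snoc hcG
  have hmod3 := WeightedGraph.mod_add_of_shortest ha₁ hd hr₂ (by rw [Nat.mul_add]; omega)
  -- By `hmod3`, `w` has hop number `l + k₁ + 1`, which is at most `l + t`; so the extended walk
  -- stays in the ball of `u'`.
  obtain ⟨b₂, hb₂, hble⟩ := (show HasCost (G.ball t u').edges u' w (n * (c₁ + c') + (k₁ + 1)) from
    ⟨_, _, WeightedGraph.reach_ball hr₂ (by omega), rfl⟩).scaledDist_le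
  have h3 := le_of_scaledDist hd
    ((hasCost_of_scaledDist ha₁).trans (WeightedGraph.hasCost_of_ball_dist hb₂))
  have hcw := candidate_eq (M := M) hx₁ hb₂ hal₁
  rw [Nat.mul_add] at hble
  rw [show a₁ + b₂ = d by omega] at hcw
  have hle : propose M d u ≤ propose M d u' := by rw [← hbest, ← hcw]; exact best_le
  rw [propose_le_propose hM] at hle
  omega

omit h in
lemma served_root (hw : Served M G s t l x u w)
    (hp : parent (G.ball t u).edges u w = none) :
    w = u ∧ ∃ a, x w = some a ∧ a % n = l ∧ best M G t l x w = propose M a w := by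
  obtain ⟨d, hd, hl, ht, hM, hc, hbest⟩ := hw
  rw [propose_of_lt hM] at hc
  obtain ⟨a, b, hx, hb, hal, hab, -⟩ := candidate_eq_coe.mp hc
  obtain rfl := eq_of_parent_eq_none hb hp
  rw [scaledDist_self, Option.some.injEq] at hb
  subst hb
  have : a = d := by simpa using hab
  exact ⟨rfl, a, hx, hal, this ▸ hbest⟩

end Bounds

end Best

/-! ### Deterministic programs composed of one-round operations -/

/-- A one-round operation. Every node sends its whole memory to its neighbors, and at most one
global message. It updates its memory from the memories of its neighbors and from the global message
that it has received, if any. -/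
structure Op (n : ℕ) (μ ι : Type) where
  send : μ → Option (Fin n × ι)
  update : μ → (Fin n → Option μ) → Option ι → μ

/-- The state of a node: its memory, the operations to be carried out before the schedule is
consulted again, and the position in the schedule. -/
structure NodeState (n : ℕ) (μ ι : Type) where
  mem : μ
  todo : List (Op n μ ι)
  stage : ℕ

/-- A deterministic algorithm that performs stages of operations until the nodes have an output. -/
structure Protocol (n : ℕ) (μ ι : Type) where
  start : NodeInput n → μ
  output : μ → Option ℕ∞
  schedule : ℕ → List (Op n μ ι)

section Codes

/-- A code of the elements of a countable type as nonempty lists of messages. -/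
noncomputable def encodeLocal (μ : Type) [Countable μ] (b : ℕ) (m : μ) : List (BitVec b) :=
  0#b :: Infinite.natEmbedding (List (BitVec b)) ((exists_injective_nat μ).choose m)

lemma encodeLocal_injective (μ : Type) [Countable μ] (b : ℕ) :
    Function.Injective (encodeLocal μ b) := by
  intro m m' h
  exact (exists_injective_nat μ).choose_spec
    ((Infinite.natEmbedding _).injective (List.cons.inj h).2)

open Classical in
/-- A code of the elements of `ι` as messages; it is injective if `ι` is small enough. -/
noncomputable def encodeGlobal (ι : Type) (b : ℕ) : ι → BitVec b :=
  if h : ∃ f : ι → BitVec b, Function.Injective f then h.choose else fun _ => 0#b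

lemma encodeGlobal_injective {ι : Type} [Fintype ι] {b : ℕ} (h : Fintype.card ι ≤ 2 ^ b) :
    Function.Injective (encodeGlobal ι b) := by
  have hex : ∃ f : ι → BitVec b, Function.Injective f := by
    have e : BitVec b ≃ Fin (2 ^ b) :=
      ⟨BitVec.toFin, BitVec.ofFin, fun _ => rfl, fun _ => rfl⟩
    obtain ⟨f⟩ := Function.Embedding.nonempty_of_card_le
      (show Fintype.card ι ≤ Fintype.card (Fin (2 ^ b)) by simpa using h)
    exact ⟨e.symm ∘ f, e.symm.injective.comp f.injective⟩
  rw [encodeGlobal, dif_pos hex]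
  exact hex.choose_spec

end Codes

section Inbox

variable {n : ℕ} {μ ι : Type}

open Classical in
/-- The content of the global message in an inbox, if there is one. -/
noncomputable def decodeInbox {b : ℕ} (D : Multiset (Fin n × BitVec b)) : Option ι :=
  if h : ∃ a, a ∈ D then Function.partialInv (encodeGlobal ι b) h.choose.2 else none

end Inbox

namespace Protocol

variable {n : ℕ} {μ ι : Type} [Countable μ] (A : Protocol n μ ι)

open Classical in
/-- The program of a protocol in the hybrid network. -/
noncomputable def toProgram (γ b : ℕ) : Program n γ b where
  State := NodeState n μ ι
  coins := 1
  coins_pos := Nat.one_pos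
  init i := ⟨A.start i, [], 0⟩
  output σ := A.output σ.mem
  sendLocal σ _ _ := encodeLocal μ b σ.mem
  sendGlobal σ _ k :=
    if k.val = 0 then
      match σ.todo with
      | [] => none
      | op :: _ => (op.send σ.mem).map fun a => (a.1, encodeGlobal ι b a.2)
    else none
  update σ _ N D :=
    match σ.todo with
    | [] => ⟨σ.mem, A.schedule σ.stage, σ.stage + 1⟩
    | op :: l => ⟨op.update σ.mem (fun u => Function.partialInv (encodeLocal μ b) (N u))
        (decodeInbox D), l, σ.stage⟩

end Protocol

namespace Op

variable {n : ℕ} {μ ι : Type} (op : Op n μ ι) (G : WeightedGraph n) (m : Fin n → μ)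

/-- No two nodes send a global message to the same node. -/
def Fair : Prop :=
  ∀ u u' v i i', op.send (m u) = some (v, i) → op.send (m u') = some (v, i') → u = u'

open Classical in
/-- The global message received by `v`. -/
noncomputable def received (v : Fin n) : Option ι :=
  if h : ∃ a : Fin n × ι, op.send (m a.1) = some (v, a.2) then some h.choose.2 else none

open Classical in
/-- The memories of the neighbors of `v`. -/
noncomputable def neighbors (v u : Fin n) : Option μ :=
  if G.graph.Adj u v then some (m u) else none

/-- The memories after the operation. -/
noncomputable def next (v : Fin n) : μ :=
  op.update (m v) (neighbors G m v) (op.received m v)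

variable {op m}

lemma Fair.received_eq_some (h : op.Fair m) {u v : Fin n} {i : ι}
    (hs : op.send (m u) = some (v, i)) : op.received m v = some i := by
  have hex : ∃ a : Fin n × ι, op.send (m a.1) = some (v, a.2) := ⟨(u, i), hs⟩
  rw [received, dif_pos hex]
  have hc := hex.choose_spec
  have := h _ _ v _ _ hc hs
  rw [this, hs] at hc
  simpa using (Option.some.inj hc).symm

lemma received_eq_some {v : Fin n} {i : ι} (h : op.received m v = some i) :
    ∃ u, op.send (m u) = some (v, i) := by
  unfold received at h
  split_ifs at h with hex
  rw [← Option.some.inj h]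
  exact ⟨_, hex.choose_spec⟩

lemma received_eq_none {v : Fin n} (h : ∀ u i, op.send (m u) ≠ some (v, i)) :
    op.received m v = none := by
  unfold received
  rw [dif_neg]
  rintro ⟨a, ha⟩
  exact h _ _ ha

lemma fair_of_send_eq_none (h : ∀ u, op.send (m u) = none) : op.Fair m := by
  intro u _ v i _ hu
  simp [h] at hu

end Op

namespace Protocol

variable {n : ℕ} {μ ι : Type} [Countable μ] {A : Protocol n μ ι} {G : WeightedGraph n}
  {γ b : ℕ}

/-- Loading a stage takes a round of its own, which accounts for the `+ 1` in `duration`. -/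
lemma step_nil {r : Fin n → Fin (A.toProgram γ b).coins} {m : Fin n → μ} {g : ℕ}
    {σ σ' : Fin n → NodeState n μ ι} (hσ : ∀ v, σ v = ⟨m v, [], g⟩)
    (hout : ∀ v, A.output (m v) = none) (h : (A.toProgram γ b).Step G r σ σ') (v : Fin n) :
    σ' v = ⟨m v, A.schedule g, g + 1⟩ := by
  obtain ⟨D, -, hD⟩ := h
  rw [hD v]
  simp [toProgram, hσ, hout]

/-- Fairness means that at most one global message, hence at most `γ`, is sent to each node. Every
admissible delivery is then complete, and the round is deterministic. -/
lemma step_cons [Fintype ι] (hγ : 1 ≤ γ) (hb : Fintype.card ι ≤ 2 ^ b)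
    {r : Fin n → Fin (A.toProgram γ b).coins} {m : Fin n → μ} {op : Op n μ ι}
    {l : List (Op n μ ι)} {g : ℕ} {σ σ' : Fin n → NodeState n μ ι}
    (hσ : ∀ v, σ v = ⟨m v, op :: l, g⟩) (hout : ∀ v, A.output (m v) = none) (hf : op.Fair m)
    (h : (A.toProgram γ b).Step G r σ σ') (v : Fin n) :
    σ' v = ⟨op.next G m v, l, g⟩ := by
  obtain ⟨D, hadm, hD⟩ := h
  have hinj := encodeGlobal_injective hb
  have hmem : ∀ v a, a ∈ (A.toProgram γ b).globalSent r σ v ↔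
      ∃ i, op.send (m a.1) = some (v, i) ∧ encodeGlobal ι b i = a.2 := by
    intro v a
    simp only [Program.globalSent, Multiset.mem_filterMap, Finset.mem_val, Finset.mem_univ,
      true_and]
    constructor
    · rintro ⟨⟨u, k⟩, hk⟩
      simp only [toProgram, hσ, hout, if_true] at hk
      split_ifs at hk with hk0
      · cases hs : op.send (m u) with
        | none => simp [hs] at hk
        | some z =>
          simp only [hs, Option.map_some, Option.bind_some] at hk
          split_ifs at hk with hz
          obtain rfl := Option.some.inj hk
          exact ⟨z.2, by rw [hs, ← hz], rfl⟩
      · simp at hk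
    · rintro ⟨i, hi, he⟩
      refine ⟨(a.1, ⟨0, hγ⟩), ?_⟩
      simp [toProgram, hσ, hout, hi, he]
  have huniq : ∀ v a a', a ∈ (A.toProgram γ b).globalSent r σ v →
      a' ∈ (A.toProgram γ b).globalSent r σ v → a = a' := by
    intro v a a' ha ha'
    obtain ⟨i, hi, he⟩ := (hmem v a).mp ha
    obtain ⟨i', hi', he'⟩ := (hmem v a').mp ha'
    have := hf _ _ v _ _ hi hi'
    rw [this, hi'] at hi
    ext1
    · exact this
    · rw [← he, ← he', show i' = i by simpa using hi]
  -- `huniq` compares messages only as values. Copies are excluded because only slot `0` is used and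
  -- the message names its sender.
  have hnodup : ∀ v, ((A.toProgram γ b).globalSent r σ v).Nodup := by
    intro v
    refine Multiset.Nodup.filterMap _ ?_ Finset.univ.nodup
    rintro ⟨u, k⟩ ⟨u', k'⟩ z hz hz'
    have hk : ∀ (u : Fin n) (k : Fin γ), (if (A.toProgram γ b).output (σ u) = none then
        ((A.toProgram γ b).sendGlobal (σ u) (r u) k).bind
          fun m => if m.1 = v then some (u, m.2) else none
        else none) = some z → z.1 = u ∧ k.val = 0 := by
      intro u k hk
      simp only [toProgram, hσ, hout, if_true] at hk
      split_ifs at hk with hk0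
      · cases hs : op.send (m u) with
        | none => simp [hs] at hk
        | some y =>
          simp only [hs, Option.map_some, Option.bind_some] at hk
          split_ifs at hk with hy
          obtain rfl := Option.some.inj hk
          exact ⟨rfl, hk0⟩
      · simp at hk
    have h1 := hk u k hz
    have h2 := hk u' k' hz'
    simp only [Prod.mk.injEq, Fin.ext_iff]
    exact ⟨by rw [← h1.1, ← h2.1], by omega⟩
  have hcard : ∀ v, Multiset.card ((A.toProgram γ b).globalSent r σ v) ≤ γ := by
    intro v
    refine le_trans ?_ hγ
    have := (Finset.card_le_one (s := ⟨_, hnodup v⟩)).mpr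
      fun a ha a' ha' => huniq v a a' ha ha'
    exact this
  have hDv := (hadm v).2.2 (hcard v)
  have hin : decodeInbox (D v) = op.received m v := by
    unfold decodeInbox
    rw [hDv]
    split_ifs with hex
    · obtain ⟨i, hi, he⟩ := (hmem v _).mp hex.choose_spec
      rw [hf.received_eq_some hi, ← he, Function.partialInv_left hinj]
    · refine (Op.received_eq_none fun u i hi => hex ⟨(u, encodeGlobal ι b i), ?_⟩).symm
      exact (hmem v _).mpr ⟨i, hi, rfl⟩
  have hloc : (fun u => Function.partialInv (encodeLocal μ b)
      ((A.toProgram γ b).localInbox G r σ v u)) = Op.neighbors G m v := by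
    funext u
    unfold Program.localInbox Op.neighbors
    by_cases hadj : G.graph.Adj u v
    · simp [toProgram, hσ, hout, hadj, Function.partialInv_left (encodeLocal_injective μ b)]
    -- Codes are nonempty lists, so the empty list from a non-neighbor decodes to `none`.
    · simp [hadj, Function.partialInv, encodeLocal]
  refine (hD v).trans ?_
  unfold Op.next
  rw [← hin, ← hloc]
  simp [toProgram, hσ, hout]

/-! ### Reasoning about lists of operations, and from stages to executions. -/

variable (A G)

/-- The weakest precondition for a list of operations: no node has an output before the end, no two
nodes send a global message to the same node, and the memories satisfy `Q` at the end. -/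
def Wp : List (Op n μ ι) → ((Fin n → μ) → Prop) → (Fin n → μ) → Prop
  | [], Q, m => Q m
  | op :: l, Q, m => (∀ v, A.output (m v) = none) ∧ op.Fair m ∧ Wp l Q (op.next G m)

variable {A G} {Q Q' : (Fin n → μ) → Prop} {m : Fin n → μ}

omit [Countable μ]

lemma Wp.mono {l : List (Op n μ ι)} (h : Wp A G l Q m) (hQ : ∀ m, Q m → Q' m) :
    Wp A G l Q' m := by
  induction l generalizing m with
  | nil => exact hQ m h
  | cons op l ih => exact ⟨h.1, h.2.1, ih h.2.2⟩

lemma Wp.append {l l' : List (Op n μ ι)} (h : Wp A G l Q m)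
    (hQ : ∀ m, Q m → Wp A G l' Q' m) : Wp A G (l ++ l') Q' m := by
  induction l generalizing m with
  | nil => exact hQ m h
  | cons op l ih => exact ⟨h.1, h.2.1, ih h.2.2⟩

lemma Wp.single {op : Op n μ ι} (hout : ∀ v, A.output (m v) = none) (hf : op.Fair m)
    (hQ : Q (op.next G m)) : Wp A G [op] Q m :=
  ⟨hout, hf, hQ⟩

lemma Wp.loop {f : ℕ → List (Op n μ ι)} {I : ℕ → (Fin n → μ) → Prop} {k : ℕ} (h0 : I 0 m)
    (h : ∀ i < k, ∀ m, I i m → Wp A G (f i) (I (i + 1)) m) :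
    Wp A G ((List.range k).flatMap f) (I k) m := by
  induction k with
  | zero => exact h0
  | succ k ih =>
    rw [List.range_succ, List.flatMap_append, List.flatMap_singleton]
    exact (ih fun i hi => h i (by omega)).append (h k (by omega))

end Protocol

namespace Protocol

variable {n : ℕ} {μ ι : Type} [Countable μ] {A : Protocol n μ ι} {G : WeightedGraph n}
  {γ b : ℕ} {s : Fin n} {T : ℕ} {ω : Fin T → Fin n → Fin (A.toProgram γ b).coins}
  {σ : ℕ → Fin n → NodeState n μ ι}

lemma output_stable (hσ : (A.toProgram γ b).IsExecution G s ω σ) {τ : ℕ} {v : Fin n} {d : ℕ∞}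
    (h : A.output (σ τ v).mem = some d) {τ' : ℕ} (hτ : τ ≤ τ') (hT : τ' ≤ T) :
    A.output (σ τ' v).mem = some d := by
  induction τ', hτ using Nat.le_induction with
  | base => exact h
  | succ τ' _ ih =>
    obtain ⟨D, -, hD⟩ := hσ.2 ⟨τ', hT⟩
    have := ih (by omega)
    have hv : σ (τ' + 1) v = σ τ' v := (hD v).trans (if_neg (by simp [toProgram, this]))
    rw [hv]
    exact this

lemma exec_todo [Fintype ι] (hγ : 1 ≤ γ) (hb : Fintype.card ι ≤ 2 ^ b)
    (hσ : (A.toProgram γ b).IsExecution G s ω σ) {l : List (Op n μ ι)}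
    {Q : (Fin n → μ) → Prop} {m : Fin n → μ} {g τ : ℕ} (hτ : ∀ v, σ τ v = ⟨m v, l, g⟩)
    (hw : Wp A G l Q m) (hT : τ + l.length ≤ T) :
    ∃ m', Q m' ∧ ∀ v, σ (τ + l.length) v = ⟨m' v, [], g⟩ := by
  induction l generalizing m τ with
  | nil => exact ⟨m, hw, hτ⟩
  | cons op l ih =>
    obtain ⟨hout, hf, hw⟩ := hw
    rw [List.length_cons] at hT ⊢
    have := step_cons hγ hb hτ hout hf (hσ.2 ⟨τ, by omega⟩)
    rw [← Nat.add_assoc, Nat.add_right_comm]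
    exact ih this hw (by omega)

/-- The number of rounds of the first `g` stages. -/
def duration (A : Protocol n μ ι) (g : ℕ) : ℕ := ∑ i ∈ Finset.range g, ((A.schedule i).length + 1)

/-- If every stage either gives all nodes the right output or leaves all of them running, and stage
`J` gives the right output, then all nodes have the right output after stage `J`. -/
theorem solvesWith [Fintype ι] (hγ : 1 ≤ γ) (hb : Fintype.card ι ≤ 2 ^ b)
    {P : (Fin n → μ) → Prop} {J : ℕ} (hP : ∀ m, P m → ∀ v, A.output (m v) = none)
    (h0 : P fun v => A.start (G.nodeInput s v))
    (hstage : ∀ g m, P m → Wp A G (A.schedule g)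
      (fun m' => (∀ v, A.output (m' v) = some (G.dist v s)) ∨ (g ≠ J ∧ P m')) m)
    (hT : A.duration (J + 1) ≤ T) : (A.toProgram γ b).SolvesWith G s ω := by
  intro σ hσ
  -- Either all nodes have finished correctly by some time, or all of them still run together at the
  -- boundary of stage `g`; at `J + 1` the second case is excluded.
  have key : ∀ g ≤ J + 1, (∃ τ ≤ T, ∀ v, A.output (σ τ v).mem = some (G.dist v s)) ∨
      (g ≠ J + 1 ∧ ∃ m, P m ∧ ∀ v, σ (A.duration g) v = ⟨m v, [], g⟩) := by
    intro g hg
    induction g with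
    | zero => exact Or.inr ⟨by omega, _, h0, hσ.1⟩
    | succ g ih =>
      rcases ih (by omega) with h | ⟨-, m, hm, hg'⟩
      · exact Or.inl h
      have hd : A.duration (g + 1) = A.duration g + 1 + (A.schedule g).length := by
        rw [duration, Finset.sum_range_succ, duration]; ring
      have hmono : A.duration (g + 1) ≤ A.duration (J + 1) :=
        Finset.sum_le_sum_of_subset (Finset.range_mono hg)
      have h1 : ∀ v, σ (A.duration g + 1) v = _ := step_nil hg' (hP m hm) (hσ.2 ⟨A.duration g, by omega⟩)
      obtain ⟨m', hm', hσ'⟩ := exec_todo (τ := A.duration g + 1) hγ hb hσ h1 (hstage g m hm) (by omega)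
      rw [← hd] at hσ'
      rcases hm' with hm' | ⟨hne, hm'⟩
      · exact Or.inl ⟨_, hmono.trans hT, fun v => by rw [hσ' v]; exact hm' v⟩
      · exact Or.inr ⟨by omega, m', hm', hσ'⟩
  obtain ⟨τ, hτ, hv⟩ := (key (J + 1) le_rfl).resolve_right (by simp)
  intro v
  exact output_stable hσ (hv v) hτ le_rfl

end Protocol

lemma Program.successProb_eq_one {n γ b : ℕ} {P : Program n γ b} {G : WeightedGraph n} {s : Fin n}
    {T : ℕ} (h : ∀ ω : Fin T → Fin n → Fin P.coins, P.SolvesWith G s ω) :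
    P.successProb G s T = 1 := by
  have : NeZero P.coins := ⟨P.coins_pos.ne'⟩
  rw [successProb, Nat.card_congr (Equiv.subtypeUnivEquiv h)]
  exact div_self (Nat.cast_ne_zero.mpr Nat.card_pos.ne')

/-! ### The memory of the nodes -/

/-- A proposal together with the node to which it is addressed. -/
abbrev Item (n M : ℕ) : Type := Fin n ×ₗ Proposal n M

/-- The memory of a node: its input; the incident edges of the nodes nearby; the corresponding
tables of the nodes nearby; an upper bound on its scaled distance; the best proposal in the current
phase; an item in the current sorting process and the item on the preceding wire; whether some bound
may be wrong; and the output. -/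
structure Memory (n M : ℕ) where
  input : NodeInput n
  near : Table n
  views : Fin n → Option (Table n)
  bound : Option ℕ
  offer : WithTop (Proposal n M)
  item : WithTop (Item n M)
  prev : WithTop (Item n M)
  alarm : Bool
  output : Option ℕ∞

instance (n : ℕ) : Countable (NodeInput n) :=
  Function.Injective.countable (f := fun i : NodeInput n => (i.id, i.isSource, i.edgeWeight))
    fun i j h => by cases i; cases j; simpa using h

instance (n M : ℕ) : Countable (WithTop (Proposal n M)) :=
  inferInstanceAs (Countable (Option (Fin M × Fin n)))

instance (n M : ℕ) : Countable (WithTop (Item n M)) :=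
  inferInstanceAs (Countable (Option (Fin n × Fin M × Fin n)))

instance (n M : ℕ) : Fintype (WithTop (Item n M)) :=
  inferInstanceAs (Fintype (Option (Fin n × Fin M × Fin n)))

instance : Countable ℕ∞ := inferInstanceAs (Countable (Option ℕ))

instance (n M : ℕ) : Countable (Memory n M) :=
  Function.Injective.countable (f := fun m : Memory n M =>
    (m.input, m.near, m.views, m.bound, m.offer, m.item, m.prev, m.alarm, m.output))
    fun i j h => by cases i; cases j; simpa using h

lemma card_withTop_item (n M : ℕ) : Fintype.card (WithTop (Item n M)) = n * (M * n) + 1 := by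
  have : Fintype.card (Option (Fin n × Fin M × Fin n)) = n * (M * n) + 1 := by simp
  rw [← this]
  exact Fintype.card_congr (Equiv.refl _)

/-- The initial memory. -/
def Memory.start {n : ℕ} (M : ℕ) (i : NodeInput n) : Memory n M where
  input := i
  near u := if u = i.id then some i.edgeWeight else none
  views _ := none
  bound := if i.isSource then some 0 else none
  offer := ⊤
  item := ⊤
  prev := ⊤
  alarm := false
  output := none

/-- The distance according to the bound on the scaled distance. -/
def Memory.result {n M : ℕ} (m : Memory n M) : ℕ∞ :=
  match m.bound with
  | some a => ((a / n : ℕ) : ℕ∞)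
  | none => ⊤

/-! ### The operations and the schedule. -/

section Operations

variable {n M : ℕ}

/-- The operations of the algorithm. -/
abbrev Operation (n M : ℕ) : Type := Op n (Memory n M) (WithTop (Item n M))

/-- An operation without global messages. -/
def Operation.silent (f : Memory n M → (Fin n → Option (Memory n M)) → Memory n M) :
    Operation n M where
  send _ := none
  update m N _ := f m N

lemma Operation.fair_silent (f : Memory n M → (Fin n → Option (Memory n M)) → Memory n M)
    (m : Fin n → Memory n M) : (Operation.silent f).Fair m :=
  Op.fair_of_send_eq_none fun _ => rfl

open Classical in
/-- The entries of a partial function, completed by those that are known to the neighbors. -/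
noncomputable def gather {α : Type} (f : Fin n → Option α) (N : Fin n → Option (Fin n → Option α))
    (u : Fin n) : Option α :=
  if (f u).isSome then f u
  else if h : ∃ a z g, N z = some g ∧ g u = some a then some h.choose else none

/-- The proposal `y` for `v`, transferred to `w` by means of the shortest-path tree that it is
based on. -/
noncomputable def relay (views : Fin n → Option (Table n)) (v w : Fin n)
    (y : WithTop (Proposal n M)) : WithTop (Proposal n M) :=
  match y with
  | ⊤ => ⊤
  | (z : Proposal n M) =>
    match views (ofLex z).2 with
    | none => ⊤
    | some K =>
      match scaledDist K.edges (ofLex z).2 v, scaledDist K.edges (ofLex z).2 w with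
      | some d, some d' => propose M ((ofLex z).1 - d + d') (ofLex z).2
      | _, _ => ⊤

/-- The item for the node that is reached by a jump of length `2 ^ k` from `v` in the tree that the
proposal `y` is based on. -/
noncomputable def dispatch (views : Fin n → Option (Table n)) (k : ℕ) (v : Fin n)
    (y : WithTop (Proposal n M)) : WithTop (Item n M) :=
  match y with
  | ⊤ => ⊤
  | (z : Proposal n M) =>
    match views (ofLex z).2 with
    | none => ⊤
    | some K =>
      match jump (parent K.edges (ofLex z).2) k v with
      | none => ⊤
      | some w => (relay views v w (z : WithTop (Proposal n M))).map fun p => toLex (w, p)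

namespace Operation

/-- Forget everything but the input. -/
def reset : Operation n M := silent fun m _ => Memory.start M m.input

/-- Learn the incident edges of nodes at a larger distance. -/
noncomputable def explore : Operation n M := silent fun m N =>
  { m with near := gather m.near fun z => (N z).map Memory.near }

/-- Make the own table known. -/
def copy : Operation n M := silent fun m _ =>
  { m with views := fun u => if u = m.input.id then some m.near else none }

/-- Learn the tables of nodes at a larger distance. -/
noncomputable def exploreViews : Operation n M := silent fun m N =>
  { m with views := gather m.views fun z => (N z).map Memory.views }

/-- Nodes with the hop number `l` become roots. -/
def begin (l : ℕ) : Operation n M := silent fun m _ =>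
  { m with offer := match m.bound with
      | some a => if a % n = l then propose M a m.input.id else ⊤
      | none => ⊤ }

/-- Learn from the neighbors. -/
noncomputable def consult : Operation n M := silent fun m N =>
  { m with offer := min m.offer (Finset.univ.inf fun z =>
      match N z with
      | some m' => relay m.views z m.input.id m'.offer
      | none => ⊤) }

/-- Prepare an item for the target of a jump. -/
noncomputable def prepare (k : ℕ) : Operation n M := silent fun m _ =>
  { m with item := dispatch m.views k m.input.id m.offer }

/-- A layer of the sorting network. -/
def exchange (p : ℕ → ℕ) : Operation n M where
  -- The node of an idle wire is its own partner and sends its item to itself.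
  send m := some (restrict n p m.input.id, m.item)
  update m _ r := { m with item :=
    if m.input.id < restrict n p m.input.id then min m.item (r.getD ⊤) else max m.item (r.getD ⊤) }

/-- Send the item to the next wire. -/
def shift : Operation n M where
  send m := if h : m.input.id.val + 1 < n then some (⟨m.input.id.val + 1, h⟩, m.item) else none
  update m _ r := { m with prev := r.getD ⊤ }

/-- Send the item to the node to which it is addressed, unless there is a better item for it. -/
def deliver : Operation n M where
  send m := match m.item with
    | ⊤ => none
    | (i : Item n M) =>
      if m.prev.map (fun j => (ofLex j).1) = ((ofLex i).1 : WithTop (Fin n)) then none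
      else some ((ofLex i).1, m.item)
  update m _ r := { m with offer := min m.offer ((r.getD ⊤).map fun j => (ofLex j).2) }

/-- Improve the bound on the distance. -/
def conclude : Operation n M := silent fun m _ =>
  { m with bound := match m.offer with
      | ⊤ => m.bound
      | (z : Proposal n M) => some (match m.bound with
        | some a => min a (ofLex z).1
        | none => (ofLex z).1) }

open Classical in
/-- Compare the bound with the bounds of the neighbors. -/
noncomputable def check : Operation n M := silent fun m N =>
  { m with alarm := !decide (∀ z m' c b, N z = some m' → m.input.edgeWeight z = some c →
      m'.bound = some b → ∃ a, m.bound = some a ∧ a ≤ b + (n * c + 1)) }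

/-- Spread the alarm. -/
def spreadAlarm (k : ℕ) : Operation n M where
  send m := if m.alarm then
    -- The content is irrelevant: the arrival of a message is the alarm.
    some (⟨(m.input.id.val + 2 ^ k) % n, Nat.mod_lt _ m.input.id.pos⟩, ⊤) else none
  update m _ r := { m with alarm := m.alarm || r.isSome }

/-- Terminate unless there was an alarm. -/
def finish : Operation n M := silent fun m _ =>
  { m with output := if m.alarm then none else some m.result }

end Operation

open Operation

/-- Deliver to every node the best of the items that are addressed to it. -/
def aggregate (n M K : ℕ) : List (Operation n M) := (sortNet K).map exchange ++ [shift, deliver]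

/-- The messages along jumps of length `2 ^ k`. -/
noncomputable def jumpRound (n M K k : ℕ) : List (Operation n M) := prepare k :: aggregate n M K

/-- One round of messages to children and along jumps. -/
noncomputable def treeRound (n M K : ℕ) : List (Operation n M) :=
  consult :: (List.range K).flatMap (jumpRound n M K)

/-- Nodes with the hop number `l` inform nodes with larger hop numbers. -/
noncomputable def phase (n M K l : ℕ) : List (Operation n M) :=
  begin l :: (((List.range K).flatMap fun _ => treeRound n M K) ++ [conclude])

/-- The computation of distances along paths of at most `t * t` edges, and its verification. -/
noncomputable def stage (n M K t : ℕ) : List (Operation n M) :=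
  reset :: (((List.range t).flatMap fun _ => [explore]) ++
    copy :: (((List.range t).flatMap fun _ => [exploreViews]) ++
      (((List.range t).flatMap fun i => phase n M K (i * t)) ++
        check :: (((List.range K).flatMap fun k => [spreadAlarm k]) ++ [finish]))))

/-- The algorithm. -/
noncomputable def algorithm (n M : ℕ) : Protocol n (Memory n M) (WithTop (Item n M)) where
  start := Memory.start M
  output := Memory.output
  schedule g := stage n M (Nat.log 2 n + 1) (2 ^ g)

end Operations

/-! ### The results of the explorations, and the transfer of proposals along trees. -/

section Correctness

variable {n M : ℕ} {G : WeightedGraph n} {s : Fin n} {t : ℕ}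

open Classical in
/-- The values of a function at the nodes that are at most `r` edges away. -/
noncomputable def known {α : Type} (G : WeightedGraph n) (f : Fin n → α) (r : ℕ) (v u : Fin n) :
    Option α :=
  if G.Near r v u then some (f u) else none

lemma known_zero {α : Type} (f : Fin n → α) (v : Fin n) :
    known G f 0 v = fun u => if u = v then some (f v) else none := by
  funext u
  by_cases h : u = v
  · subst h; simp [known, WeightedGraph.near_zero]
  · simp [known, WeightedGraph.near_zero, h, Ne.symm h]

/-- The arbitrary choice in `gather` is harmless, as all known entries are values of the same `f`.
-/
lemma gather_known {α : Type} {f : Fin n → α} {r : ℕ} {v : Fin n}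
    {N : Fin n → Option (Fin n → Option α)}
    (h : ∀ z g, N z = some g ↔ G.graph.Adj v z ∧ g = known G f r z) :
    gather (known G f r v) N = known G f (r + 1) v := by
  funext u
  unfold gather
  by_cases h0 : G.Near r v u
  · have h1 := WeightedGraph.near_succ.mpr (Or.inl h0)
    simp [known, h0, h1]
  · rw [if_neg (by simp [known, h0])]
    by_cases h1 : ∃ z, G.graph.Adj v z ∧ G.Near r z u
    · have h2 := WeightedGraph.near_succ.mpr (Or.inr h1)
      have hval : ∀ a z g, N z = some g ∧ g u = some a → a = f u := by
        rintro a z g ⟨hz, ha⟩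
        obtain ⟨-, rfl⟩ := (h z g).mp hz
        unfold known at ha
        split_ifs at ha
        exact (Option.some.inj ha).symm
      obtain ⟨z, hz, hzu⟩ := h1
      have hex : ∃ a z g, N z = some g ∧ g u = some a :=
        ⟨f u, z, _, (h z _).mpr ⟨hz, rfl⟩, by simp [known, hzu]⟩
      rw [dif_pos hex]
      obtain ⟨z', g', hc⟩ := hex.choose_spec
      simp [known, h2, hval _ _ _ hc]
    · have h2 : ¬ G.Near (r + 1) v u := by
        rw [WeightedGraph.near_succ]
        rintro (h | h)
        exacts [h0 h, h1 h]
      rw [dif_neg]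
      · simp [known, h2]
      · rintro ⟨a, z, g, hz, ha⟩
        obtain ⟨hadj, rfl⟩ := (h z g).mp hz
        refine h1 ⟨z, hadj, ?_⟩
        by_contra hn
        simp [known, hn] at ha

lemma neighbors_map_eq_some {μ α : Type} {m : Fin n → μ} {f : μ → α} {v z : Fin n} {g : α} :
    (Op.neighbors G m v z).map f = some g ↔ G.graph.Adj v z ∧ g = f (m z) := by
  unfold Op.neighbors
  rw [G.graph.adj_comm v z]
  by_cases h : G.graph.Adj z v <;> simp [h, eq_comm]

lemma neighbors_eq_some {μ : Type} {m : Fin n → μ} {v z : Fin n} {g : μ} :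
    Op.neighbors G m v z = some g ↔ G.graph.Adj v z ∧ g = m z := by
  simpa using neighbors_map_eq_some (G := G) (m := m) (f := id) (v := v) (z := z) (g := g)

section Relay

variable {l : ℕ} {x : Fin n → Option ℕ} {u v w z : Fin n}

/-- Subtracting the tree distance of `v` recovers the bound of the root, which need not be known.
Whichever of `v` and `w` computes this gets it right: `v` sees the root `u`, and if `w` does not,
then `w` is outside the ball and both sides are `⊤`. -/
lemma relay_candidate (hz : z = v ∨ z = w) (hc : candidate M G t l x u v ≠ ⊤) :
    relay (known G (G.ball t) t z) v w (candidate M G t l x u v) = candidate M G t l x u w := by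
  obtain ⟨p, hp⟩ := WithTop.ne_top_iff_exists.mp hc
  obtain ⟨a, d, hx, hd, hl, hval, hu⟩ := candidate_eq_coe.mp hp.symm
  rw [← hp]
  simp only [relay]
  rw [← hu, ← hval]
  have hv := (WeightedGraph.near_of_ball_dist hd).symm
  by_cases hn : G.Near t z u
  · simp only [known, hn, if_true, hd]
    cases hw : scaledDist (G.ball t u).edges u w with
    | none => simp [candidate, hx, hw]
    | some d' => rw [candidate_eq hx hw hl]; simp
  · simp only [known, hn, if_false]
    have hzw : z = w := by
      rcases hz with rfl | rfl
      · exact absurd hv hn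
      · rfl
    cases hw : scaledDist (G.ball t u).edges u w with
    | none => simp [candidate, hx, hw]
    | some d' => exact absurd (hzw ▸ (WeightedGraph.near_of_ball_dist hw).symm) hn

lemma dispatch_candidate {k : ℕ} {i : Item n M}
    (h : dispatch (known G (G.ball t) t v) k v (candidate M G t l x u v) = i) :
    candidate M G t l x u (ofLex i).1 = ((ofLex i).2 : WithTop (Proposal n M)) := by
  have hc : candidate M G t l x u v ≠ ⊤ := by
    intro htop
    simp [htop, dispatch] at h
  obtain ⟨p, hp⟩ := WithTop.ne_top_iff_exists.mp hc
  have hrelay := fun w => relay_candidate (M := M) (w := w) (Or.inl rfl : v = v ∨ v = w) hc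
  rw [← hp] at h hrelay
  simp only [dispatch] at h
  split at h
  · simp at h
  · split at h
    · simp at h
    · rw [hrelay, WithTop.map_eq_some_iff] at h
      obtain ⟨y, hy, rfl⟩ := h
      exact hy

lemma dispatch_of_jump {k : ℕ} (hc : candidate M G t l x u v ≠ ⊤)
    (hw : jump (parent (G.ball t u).edges u) k v = some w) :
    dispatch (known G (G.ball t) t v) k v (candidate M G t l x u v) =
      (candidate M G t l x u w).map fun p => toLex (w, p) := by
  obtain ⟨p, hp⟩ := WithTop.ne_top_iff_exists.mp hc
  have hrelay := relay_candidate (M := M) (w := w) (Or.inl rfl : v = v ∨ v = w) hc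
  obtain ⟨a, d, hx, hd, hl, hval, hu⟩ := candidate_eq_coe.mp hp.symm
  rw [← hp] at hrelay ⊢
  have hv := (WeightedGraph.near_of_ball_dist hd).symm
  simp only [dispatch, ← hu, known, hv, if_true, hw]
  rw [← hrelay]

end Relay

end Correctness

open Operation

/-! ### Correctness of the aggregation -/

section Aggregation

variable {n M : ℕ} {G : WeightedGraph n}

lemma wp_exchange {l : List (ℕ → ℕ)} (hl : ∀ p ∈ l, Function.Involutive p)
    {m : Fin n → Memory n M} (hid : ∀ v, (m v).input.id = v) (hout : ∀ v, (m v).output = none) :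
    Protocol.Wp (algorithm n M) G (l.map exchange)
      (fun m' => ∀ v, m' v = { m v with item := runFin n l (fun u => (m u).item) v }) m := by
  induction l generalizing m with
  | nil => exact fun v => rfl
  | cons p l ih =>
    have hinv := restrict_involutive n (hl p (by simp))
    have hfair : (exchange p : Operation n M).Fair m := by
      intro u u' v i i' hu hu'
      simp only [exchange, hid, Option.some.injEq, Prod.mk.injEq] at hu hu'
      exact hinv.injective (hu.1.trans hu'.1.symm)
    have hnext : ∀ v, (exchange p).next G m v =
        { m v with item := finLayer (restrict n p) (fun u => (m u).item) v } := by
      intro v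
      have hr : (exchange p : Operation n M).received m v = some (m (restrict n p v)).item :=
        hfair.received_eq_some (u := restrict n p v) (by simp [exchange, hid, hinv v])
      rw [Op.next, hr]
      simp only [exchange, hid, Option.getD_some, finLayer]
    refine ⟨hout, hfair, ?_⟩
    have := ih (fun q hq => hl q (by simp [hq])) (m := (exchange p).next G m)
      (fun v => by rw [hnext v]; exact hid v) (fun v => by rw [hnext v]; exact hout v)
    refine this.mono fun m' hm' v => ?_
    rw [hm' v]
    simp only [hnext, runFin, List.foldl_cons]

/-- The item on the preceding wire. -/
def shifted {α : Type} [Top α] (f : Fin n → α) (v : Fin n) : α :=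
  if h : v.val = 0 then ⊤ else f ⟨v.val - 1, by omega⟩

lemma wp_shift {m : Fin n → Memory n M} (hid : ∀ v, (m v).input.id = v) :
    (shift : Operation n M).Fair m ∧
    ∀ v, shift.next G m v = { m v with prev := shifted (fun u => (m u).item) v } := by
  have hfair : (shift : Operation n M).Fair m := by
    intro u u' v i i' hu hu'
    simp only [shift, hid] at hu hu'
    split_ifs at hu hu' with h1 h2
    simp only [Option.some.injEq, Prod.mk.injEq] at hu hu'
    have := hu.1.trans hu'.1.symm
    simp only [Fin.mk.injEq] at this
    exact Fin.ext (by omega)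
  refine ⟨hfair, fun v => ?_⟩
  by_cases h : v.val = 0
  · have hr : (shift : Operation n M).received m v = none := by
      refine Op.received_eq_none fun u i hu => ?_
      simp only [shift, hid] at hu
      split_ifs at hu
      simp only [Option.some.injEq, Prod.mk.injEq] at hu
      rw [← hu.1] at h
      simp at h
    rw [Op.next, hr]
    simp [shift, shifted, h]
  · have hr : (shift : Operation n M).received m v = some (m ⟨v.val - 1, by omega⟩).item := by
      refine hfair.received_eq_some (u := ⟨v.val - 1, by omega⟩) ?_
      have h1 : v.val - 1 + 1 = v.val := by omega
      simp [shift, hid, h1]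
    rw [Op.next, hr]
    simp [shift, shifted, h]

lemma target_le {i j : Item n M} (h : (i : WithTop (Item n M)) ≤ j) :
    (ofLex i).1 ≤ (ofLex j).1 := by
  rw [WithTop.coe_le_coe, Prod.Lex.le_iff] at h
  rcases h with h | h
  · exact h.le
  · exact h.1.le

lemma payload_le {i j : Item n M} (h : (i : WithTop (Item n M)) ≤ j)
    (he : (ofLex i).1 = (ofLex j).1) : (ofLex i).2 ≤ (ofLex j).2 := by
  rw [WithTop.coe_le_coe, Prod.Lex.le_iff] at h
  rcases h with h | h
  · exact absurd he h.ne
  · exact h.2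

lemma deliver_send_eq_some {m : Memory n M} {v : Fin n} {j : WithTop (Item n M)} :
    deliver.send m = some (v, j) ↔ ∃ i : Item n M, m.item = i ∧ (ofLex i).1 = v ∧ j = i ∧
      m.prev.map (fun j => (ofLex j).1) ≠ (v : WithTop (Fin n)) := by
  simp only [deliver]
  cases h : m.item using WithTop.recTopCoe with
  | top => simp
  | coe i =>
    dsimp only
    split_ifs with hp
    · simp only [WithTop.coe_inj, false_iff]
      rintro ⟨_, rfl, rfl, -, hne⟩
      exact hne hp
    · simp only [Option.some.injEq, Prod.mk.injEq, WithTop.coe_inj]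
      constructor
      · rintro ⟨rfl, rfl⟩
        exact ⟨i, rfl, rfl, rfl, hp⟩
      · rintro ⟨_, rfl, rfl, rfl, -⟩
        exact ⟨rfl, rfl⟩

/-- In sorted order the items for one target occupy consecutive wires, the best first, and exactly
the first wire sends. -/
lemma wp_deliver {m : Fin n → Memory n M}
    (hmono : Monotone fun u => (m u).item)
    (hprev : ∀ v, (m v).prev = shifted (fun u => (m u).item) v) :
    (deliver : Operation n M).Fair m ∧
    ∃ y : Fin n → WithTop (Proposal n M), (∀ v, deliver.next G m v = { m v with offer := y v }) ∧
      (∀ v, y v ≤ (m v).offer) ∧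
      (∀ v (i : Item n M), (m v).item = i → y (ofLex i).1 ≤ ((ofLex i).2 : Proposal n M)) ∧
      ∀ w, y w = (m w).offer ∨
        ∃ (v : Fin n) (i : Item n M), (m v).item = i ∧ (ofLex i).1 = w ∧ y w = (ofLex i).2 := by
  -- If two wires `u < u'` held items for `v`, the wire before `u'` would hold one too by
  -- monotonicity, and `u'` would stay silent.
  have hlt : ∀ {u u' : Fin n} {v j j'}, deliver.send (m u) = some (v, j) →
      deliver.send (m u') = some (v, j') → ¬ u < u' := by
    intro u u' v j j' hu hu' huu
    obtain ⟨i, hi, hiv, -, -⟩ := deliver_send_eq_some.mp hu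
    obtain ⟨i', hi', hiv', -, hne⟩ := deliver_send_eq_some.mp hu'
    have hz : u'.val ≠ 0 := by rw [Fin.lt_def] at huu; omega
    rw [hprev, shifted, dif_neg hz] at hne
    have h1 := hmono (show u ≤ ⟨u'.val - 1, by omega⟩ by
      rw [Fin.lt_def] at huu; rw [Fin.le_def]; simp only; omega)
    have h2 := hmono (show ⟨u'.val - 1, by omega⟩ ≤ u' by rw [Fin.le_def]; simp only; omega)
    simp only [hi, hi'] at h1 h2
    cases hk : (m ⟨u'.val - 1, by omega⟩).item using WithTop.recTopCoe with
    | top => rw [hk] at h2; simp at h2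
    | coe k =>
      rw [hk] at h1 h2 hne
      have h3 := target_le h1
      have h4 := target_le h2
      rw [hiv] at h3
      rw [hiv'] at h4
      exact hne (by rw [WithTop.map_coe, le_antisymm h4 h3])
  have hfair : (deliver : Operation n M).Fair m := by
    intro u u' v i i' hu hu'
    exact le_antisymm (not_lt.mp (hlt hu' hu)) (not_lt.mp (hlt hu hu'))
  refine ⟨hfair, fun v => min (m v).offer
    (((deliver.received m v).getD ⊤).map fun j => (ofLex j).2), fun v => rfl,
    fun v => min_le_left _ _, ?_, ?_⟩
  · intro v i hi
    -- The least wire with this target is the one that sends, and its payload is the smallest.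
    have hex : ∃ k : ℕ, ∃ h : k < n, ∃ j : Item n M, (m ⟨k, h⟩).item = j ∧
        (ofLex j).1 = (ofLex i).1 := ⟨v, v.2, i, hi, rfl⟩
    classical
    obtain ⟨hk, j, hj, hji⟩ := Nat.find_spec hex
    have hle : (⟨Nat.find hex, hk⟩ : Fin n) ≤ v := Nat.find_min' hex ⟨v.2, i, hi, rfl⟩
    have hs : deliver.send (m ⟨Nat.find hex, hk⟩) = some ((ofLex i).1, (j : WithTop (Item n M))) := by
      refine deliver_send_eq_some.mpr ⟨j, hj, hji, rfl, ?_⟩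
      rw [hprev, shifted]
      split_ifs with h0
      · simp
      · intro hmap
        rw [WithTop.map_eq_some_iff] at hmap
        obtain ⟨j', hj', hji'⟩ := hmap
        exact Nat.find_min hex (Nat.sub_lt (Nat.pos_of_ne_zero h0) Nat.one_pos) ⟨_, j', hj', hji'⟩
    refine (min_le_right _ _).trans ?_
    rw [hfair.received_eq_some hs, Option.getD_some, WithTop.map_coe, WithTop.coe_le_coe]
    have := hmono hle
    simp only [hj, hi] at this
    exact payload_le this hji
  · intro w
    cases hr : deliver.received m w with
    | none => left; simp [hr]
    | some j =>
      obtain ⟨u, hu⟩ := Op.received_eq_some hr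
      obtain ⟨i, hi, hiw, rfl, -⟩ := deliver_send_eq_some.mp hu
      simp only [hr, Option.getD_some, WithTop.map_coe]
      rcases min_choice (m w).offer ((ofLex i).2 : WithTop (Proposal n M)) with h | h
      · exact Or.inl h
      · exact Or.inr ⟨u, i, hi, hiw, h⟩

/-- The nodes receive the best of the items addressed to them. -/
lemma wp_aggregate {K : ℕ} (hK : n ≤ 2 ^ K) {m : Fin n → Memory n M}
    (hid : ∀ v, (m v).input.id = v) (hout : ∀ v, (m v).output = none) :
    Protocol.Wp (algorithm n M) G (aggregate n M K)
      (fun m' => ∃ (y : Fin n → WithTop (Proposal n M)) (it pr : Fin n → WithTop (Item n M)),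
        (∀ v, m' v = { m v with offer := y v, item := it v, prev := pr v }) ∧
        (∀ v, y v ≤ (m v).offer) ∧
        (∀ v (i : Item n M), (m v).item = i → y (ofLex i).1 ≤ ((ofLex i).2 : Proposal n M)) ∧
        ∀ w, y w = (m w).offer ∨
          ∃ (v : Fin n) (i : Item n M), (m v).item = i ∧ (ofLex i).1 = w ∧ y w = (ofLex i).2) m := by
  have hinv : ∀ p ∈ sortNet K, Function.Involutive p := fun _ => involutive_of_mem_sortNet
  refine (wp_exchange hinv hid hout).append fun m₁ hm₁ => ?_
  have hid₁ : ∀ v, (m₁ v).input.id = v := fun v => by rw [hm₁ v]; exact hid v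
  obtain ⟨hf, hnext⟩ := wp_shift (G := G) hid₁
  set f := runFin n (sortNet K) fun u => (m u).item with hfdef
  have hitem : (fun u => (m₁ u).item) = f := funext fun u => by rw [hm₁ u]
  set m₂ := shift.next G m₁
  have hm₂ : ∀ v, m₂ v = { m v with item := f v, prev := shifted f v } := fun v => by
    rw [hnext v, hitem, hm₁ v]
  have hitem₂ : (fun u => (m₂ u).item) = f := funext fun u => by rw [hm₂ u]
  obtain ⟨hf₂, y, h1, h2, h3, h4⟩ := wp_deliver (G := G) (m := m₂)
    (by rw [hitem₂]; exact monotone_runFin_sortNet hK _)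
    (fun v => by rw [hitem₂, hm₂ v])
  have hrange : Set.range f = Set.range fun u => (m u).item := range_runFin hinv _
  refine ⟨fun v => ?_, hf, fun v => ?_, hf₂, y, f, shifted f, fun v => ?_, fun v => ?_,
    fun v i hi => ?_, fun w => ?_⟩
  · rw [hm₁ v]; exact hout v
  · show (m₂ v).output = none
    rw [hm₂ v]; exact hout v
  · rw [h1 v, hm₂ v]
  · have := h2 v
    rw [hm₂ v] at this
    exact this
  · obtain ⟨u, hu⟩ : (i : WithTop (Item n M)) ∈ Set.range f := by
      rw [hrange]; exact ⟨v, hi⟩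
    exact h3 u i (by rw [hm₂ u]; exact hu)
  · rcases h4 w with h | ⟨v, i, hi, hiw, hy⟩
    · left; rw [h, hm₂ w]
    · right
      obtain ⟨u, hu⟩ : (i : WithTop (Item n M)) ∈ Set.range fun u => (m u).item := by
        rw [← hrange]; rw [hm₂ v] at hi; exact ⟨v, hi⟩
      exact ⟨u, i, hu, hiw, hy⟩

end Aggregation

/-! ### Correctness of a phase -/

section Phase

variable {n M : ℕ} {G : WeightedGraph n} {s : Fin n} {t l K : ℕ} {x : Fin n → Option ℕ}

/-- What the nodes know at the beginning of a phase: their input, the surroundings of the nodes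
nearby, and the bounds `x`. -/
structure Informed (G : WeightedGraph n) (s : Fin n) (t : ℕ) (x : Fin n → Option ℕ)
    (m : Fin n → Memory n M) : Prop where
  input : ∀ v, (m v).input = G.nodeInput s v
  views : ∀ v, (m v).views = known G (G.ball t) t v
  bound : ∀ v, (m v).bound = x v
  output : ∀ v, (m v).output = none

/-- The state of a phase after `r` rounds of messages and `k` steps of the next one: the offers are
proposals by roots, and they are optimal where information from the right root has arrived. -/
structure Progress (G : WeightedGraph n) (s : Fin n) (t l K : ℕ) (x : Fin n → Option ℕ) (r k : ℕ)
    (m : Fin n → Memory n M) : Prop extends Informed G s t x m where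
  sound : ∀ v, (m v).offer = ⊤ ∨ ∃ u, (m v).offer = candidate M G t l x u v
  optimal : ∀ u v, Spreads (parent (G.ball t u).edges u) (Served M G s t l x u) K r k v →
    (m v).offer ≤ best M G t l x v

namespace Progress

variable {r k : ℕ} {m m' : Fin n → Memory n M}

lemma best_le_offer (h : Progress G s t l K x r k m) (v : Fin n) :
    best M G t l x v ≤ (m v).offer := by
  rcases h.sound v with h | ⟨u, h⟩
  · rw [h]; exact le_top
  · rw [h]; exact best_le

/-- Soundness keeps offers above the best proposal, and arrival of the information keeps them below
it. -/
lemma offer_eq (h : Progress G s t l K x r k m) {u v : Fin n}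
    (hs : Spreads (parent (G.ball t u).edges u) (Served M G s t l x u) K r k v) :
    (m v).offer = candidate M G t l x u v ∧ candidate M G t l x u v ≠ ⊤ := by
  have h1 := le_antisymm (h.optimal u v hs) (h.best_le_offer v)
  obtain ⟨d, -, -, -, hM, hc, hb⟩ := hs.isGood
  rw [h1, hc, hb, propose_of_lt hM]
  exact ⟨rfl, WithTop.coe_ne_top⟩

end Progress

lemma Served.best_eq {u v : Fin n} (h : Served M G s t l x u v) :
    best M G t l x v = candidate M G t l x u v := by
  obtain ⟨d, -, -, -, -, hc, hb⟩ := h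
  rw [hc, hb]

lemma wp_begin {m : Fin n → Memory n M} (h : Informed G s t x m) :
    Progress G s t l K x 0 0 ((begin l).next G m) := by
  have hoffer : ∀ v, ((begin l).next G m v).offer = match x v with
      | some a => if a % n = l then propose M a v else ⊤
      | none => ⊤ := by
    intro v
    simp only [Op.next, begin, silent, h.bound, h.input]
    rfl
  refine ⟨⟨h.input, h.views, h.bound, h.output⟩, fun v => ?_, fun u v hs => ?_⟩
  · rw [hoffer]
    cases hx : x v with
    | none => exact Or.inl rfl
    | some a =>
      right
      refine ⟨v, ?_⟩
      simp [candidate, hx, scaledDist_self]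
  · cases hs with
    | root hg hp =>
      obtain ⟨rfl, a, hx, hl, hb⟩ := Bounds.served_root hg hp
      rw [hoffer, hx, hb]
      simp [hl]

lemma wp_consult {r : ℕ} {m : Fin n → Memory n M} (h : Progress G s t l K x r 0 m) :
    Progress G s t l K x r 1 (consult.next G m) := by
  set z := fun v => Finset.univ.inf fun u =>
      match Op.neighbors G m v u with
      | some m' => relay (known G (G.ball t) t v) u v m'.offer
      | none => (⊤ : WithTop (Proposal n M)) with hz
  have hoffer : ∀ v, (consult.next G m v).offer = min (m v).offer (z v) := by
    intro v
    simp only [Op.next, consult, silent, h.views, h.input]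
    rfl
  have hsound : ∀ v, (m v).offer = ⊤ ∨
      (m v).offer ≠ ⊤ ∧ ∃ u, (m v).offer = candidate M G t l x u v := by
    intro v
    by_cases ht : (m v).offer = ⊤
    · exact Or.inl ht
    · exact Or.inr ⟨ht, (h.sound v).resolve_left ht⟩
  refine ⟨⟨h.input, h.views, h.bound, h.output⟩, fun v => ?_, fun u v hs => ?_⟩
  · rw [hoffer]
    rcases min_choice (m v).offer (z v) with hm | hm
    · rw [hm]; exact h.sound v
    · rw [hm]
      obtain ⟨u, -, hu⟩ := Finset.exists_mem_eq_inf Finset.univ ⟨v, Finset.mem_univ v⟩ fun u =>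
        match Op.neighbors G m v u with
        | some m' => relay (known G (G.ball t) t v) u v m'.offer
        | none => (⊤ : WithTop (Proposal n M))
      rw [hz]
      simp only
      rw [hu]
      cases hN : Op.neighbors G m v u with
      | none => exact Or.inl rfl
      | some m' =>
        obtain ⟨-, rfl⟩ := neighbors_eq_some.mp hN
        dsimp only
        rcases hsound u with ht | ⟨hne, u', hu'⟩
        · rw [ht]; exact Or.inl rfl
        · rw [hu'] at hne ⊢
          rw [relay_candidate (Or.inr rfl) hne]
          exact Or.inr ⟨u', rfl⟩
  · rw [hoffer]
    cases hs with
    | start hs => exact (min_le_left _ _).trans (h.optimal u v hs)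
    | @child _ p _ hg hp hs =>
      refine (min_le_right _ _).trans ?_
      obtain ⟨ho, hne⟩ := h.offer_eq hs
      obtain ⟨_, c, -, hc, -⟩ := precedes_of_parent hp
      have hadj := (WeightedGraph.edges_eq_some.mp (WeightedGraph.edges_of_ball _ _ _ hc)).1
      have hle : z v ≤ _ := Finset.inf_le (Finset.mem_univ p)
      refine hle.trans ?_
      rw [neighbors_eq_some.mpr ⟨hadj.symm, rfl⟩]
      dsimp only
      rw [ho, relay_candidate (Or.inr rfl) hne, hg.best_eq]

/-- A served node prepares precisely the proposal of its root for the jump target. Items competing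
for this target can only replace it by a smaller genuine proposal, hence by none if it is already
the best. -/
lemma wp_jumpRound (hK : n ≤ 2 ^ K) {r k : ℕ} {m : Fin n → Memory n M}
    (h : Progress G s t l K x r (k + 1) m) :
    Protocol.Wp (algorithm n M) G (jumpRound n M K k)
      (Progress G s t l K x r (k + 2)) m := by
  refine ⟨h.output, fair_silent _ _, ?_⟩
  set m₁ := (prepare k).next G m
  have hitem : ∀ v, (m₁ v).item = dispatch (known G (G.ball t) t v) k v (m v).offer := by
    intro v
    simp only [m₁, Op.next, prepare, silent, h.views, h.input]
    rfl
  refine (wp_aggregate hK (m := m₁) (fun v => ?_) h.output).mono ?_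
  · show (m v).input.id = v
    rw [h.input]; rfl
  rintro m' ⟨y, it, pr, hm', h1, h2, h3⟩
  have hoffer : ∀ v, (m' v).offer = y v := fun v => by rw [hm' v]
  refine ⟨⟨fun v => ?_, fun v => ?_, fun v => ?_, fun v => ?_⟩, fun w => ?_, fun u w hs => ?_⟩
  · rw [hm' v]; exact h.input v
  · rw [hm' v]; exact h.views v
  · rw [hm' v]; exact h.bound v
  · rw [hm' v]; exact h.output v
  · rw [hoffer]
    rcases h3 w with hy | ⟨v, i, hi, rfl, hy⟩
    · rw [hy]; exact h.sound w
    · right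
      rw [hitem] at hi
      rcases h.sound v with ho | ⟨u, ho⟩
      · rw [ho] at hi
        simp [dispatch] at hi
      · rw [ho] at hi
        exact ⟨u, by rw [hy, dispatch_candidate hi]⟩
  · rw [hoffer]
    cases hs with
    | stay hs => exact (h1 w).trans (h.optimal u w hs)
    | @jump _ _ v _ hg hj hs =>
      obtain ⟨ho, hne⟩ := h.offer_eq hs
      have hi := hitem v
      rw [ho, dispatch_of_jump hne hj, ← hg.best_eq] at hi
      obtain ⟨d, -, -, -, hM, -, hb⟩ := hg
      rw [hb, propose_of_lt hM] at hi ⊢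
      exact h2 v _ hi

lemma wp_treeRound (hK : n ≤ 2 ^ K) {r : ℕ} {m : Fin n → Memory n M}
    (h : Progress G s t l K x r 0 m) :
    Protocol.Wp (algorithm n M) G (treeRound n M K) (Progress G s t l K x (r + 1) 0) m := by
  refine ⟨h.output, fair_silent _ _, ?_⟩
  refine (Protocol.Wp.loop (I := fun k => Progress G s t l K x r (k + 1)) (wp_consult h)
    fun _ _ _ hm => wp_jumpRound hK hm).mono fun m hm => ?_
  exact ⟨hm.toInformed, hm.sound, fun u v hs => by
    cases hs with
    | next hs => exact hm.optimal u v hs⟩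

lemma wp_phase (hK : n ≤ 2 ^ K) (hlog : Nat.log 2 n < K) {m : Fin n → Memory n M}
    (h : Informed G s t x m) (hx : Bounds M G s l x) :
    Protocol.Wp (algorithm n M) G (phase n M K l)
      (fun m' => ∃ x', Informed G s t x' m' ∧ Bounds M G s (l + t) x') m := by
  refine ⟨h.output, fair_silent _ _, ?_⟩
  refine (Protocol.Wp.loop (I := fun r => Progress G s t l K x r 0) (wp_begin h)
    fun r _ m hm => wp_treeRound hK hm).append fun m hm => ?_
  refine ⟨hm.output, fair_silent _ _, ?_⟩
  set x' := fun v => (conclude.next G m v).bound with hx'def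
  have hx' : ∀ v, x' v = match (m v).offer with
      | ⊤ => x v
      | (z : Proposal n M) => some (match x v with
        | some a => min a (ofLex z).1
        | none => (ofLex z).1) := by
    intro v
    simp only [hx'def, Op.next, conclude, silent, hm.bound]
  have hsound : ∀ v (z : Proposal n M), (m v).offer = z → HasCost G.edges s v (ofLex z).1 := by
    intro v z hz
    rcases hm.sound v with ho | ⟨u, ho⟩
    · rw [ho] at hz
      cases hz
    · rw [ho] at hz
      obtain ⟨a, d, hxu, hd, -, hval, -⟩ := candidate_eq_coe.mp hz
      rw [← hval]
      exact (hx.sound u a hxu).trans (WeightedGraph.hasCost_of_ball_dist hd)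
  refine ⟨x', ⟨hm.input, hm.views, fun v => rfl, hm.output⟩, fun v a hv => ?_, fun v d hd hle => ?_,
    hx.small⟩
  · rw [hx'] at hv
    cases ho : (m v).offer using WithTop.recTopCoe with
    | top =>
      rw [ho] at hv
      exact hx.sound v a hv
    | coe z =>
      rw [ho] at hv
      have hz := hsound v z ho
      cases hxv : x v with
      | none =>
        simp only [hxv, Option.some.injEq] at hv
        exact hv ▸ hz
      | some b =>
        simp only [hxv, Option.some.injEq] at hv
        rcases min_choice b ((ofLex z).1 : ℕ) with hmin | hmin
        · rw [← hv, hmin]; exact hx.sound v b hxv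
        · rw [← hv, hmin]; exact hz
  · rw [hx']
    -- Up to hop number `l` the bound is already exact and sound offers cannot lower it; beyond `l`
    -- the offer itself is exact.
    rcases le_total (d % n) l with hl | hl
    · rw [hx.exact v d hd hl]
      cases ho : (m v).offer using WithTop.recTopCoe with
      | top => rfl
      | coe z =>
        dsimp only
        rw [min_eq_left (le_of_scaledDist hd (hsound v z ho))]
    · obtain ⟨u, hu⟩ := hx.exists_served (t := t) hd hl hle
      -- Ranks are at most `Nat.log 2 n < K`, so `K` rounds reach even nodes of rank `0`.
      have hs := Spreads.reach (K := K) (fun w v hw hp => hx.served_parent hw hp)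
        (getD_scaledDist_lt (e := (G.ball t u).edges) (u := u)) (by rwa [Fintype.card_fin])
        rank_le_log (r := K) hu (by rw [Fintype.card_fin]; omega)
      have hopt := hm.optimal u v hs
      obtain ⟨d', hd', -, -, hM, -, hb⟩ := hu
      obtain rfl : d' = d := by simpa [hd] using hd'.symm
      rw [hb] at hopt
      cases ho : (m v).offer using WithTop.recTopCoe with
      | top => rw [ho, propose_of_lt hM] at hopt; simp at hopt
      | coe z =>
        have hz := hsound v z ho
        have h1 := le_of_scaledDist hd hz
        have h2 : ((ofLex z).1 : ℕ) ≤ d' := by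
          rw [ho, ← (propose_eq_coe (a := ((ofLex z).1 : ℕ)) (u := (ofLex z).2)).mpr ⟨rfl, rfl⟩,
            propose_le_propose (ofLex z).1.2] at hopt
          omega
        dsimp only
        cases hxv : x v with
        | none => simp; omega
        | some b =>
          have h3 := le_of_scaledDist hd (hx.sound v b hxv)
          simp; omega

end Phase

/-! ### Correctness of the algorithm -/

section Stages

variable {n M : ℕ} {G : WeightedGraph n} {s : Fin n} {t K : ℕ} {x : Fin n → Option ℕ}

lemma wp_explore (r : ℕ) {m : Fin n → Memory n M}
    (h : m = fun v => { Memory.start M (G.nodeInput s v) with near := known G G.edges r v }) :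
    Protocol.Wp (algorithm n M) G [explore] (fun m' => m' = fun v =>
      { Memory.start M (G.nodeInput s v) with near := known G G.edges (r + 1) v }) m := by
  refine .single (fun v => by rw [h]; rfl) (fair_silent _ _) ?_
  funext v
  have := gather_known (G := G) (f := G.edges) (r := r) (v := v)
    (N := fun z => (Op.neighbors G m v z).map Memory.near)
    fun z g => by rw [neighbors_map_eq_some, h]
  rw [← this]
  simp only [Op.next, explore, silent, h]

lemma wp_exploreViews (r : ℕ) {m : Fin n → Memory n M}
    (h : m = fun v => { Memory.start M (G.nodeInput s v) with
      near := G.ball t v, views := known G (G.ball t) r v }) :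
    Protocol.Wp (algorithm n M) G [exploreViews] (fun m' => m' = fun v =>
      { Memory.start M (G.nodeInput s v) with
        near := G.ball t v, views := known G (G.ball t) (r + 1) v }) m := by
  refine .single (fun v => by rw [h]; rfl) (fair_silent _ _) ?_
  funext v
  have := gather_known (G := G) (f := G.ball t) (r := r) (v := v)
    (N := fun z => (Op.neighbors G m v z).map Memory.views)
    fun z g => by rw [neighbors_map_eq_some, h]
  rw [← this]
  simp only [Op.next, exploreViews, silent, h]

/-- The nodes know their input and have no output. -/
def Ready (G : WeightedGraph n) (s : Fin n) (m : Fin n → Memory n M) : Prop :=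
  ∀ v, (m v).input = G.nodeInput s v ∧ (m v).output = none

/-- The bounds at the beginning of a stage. -/
noncomputable def startBound (s v : Fin n) : Option ℕ := if v = s then some 0 else none

lemma bounds_startBound (hM : ∀ v d, scaledDist G.edges s v = some d → d < M) :
    Bounds M G s 0 (startBound s) := by
  refine ⟨fun v a h => ?_, fun v d hd h0 => ?_, hM⟩
  · unfold startBound at h
    split_ifs at h with hv
    obtain rfl := Option.some.inj h
    exact hv ▸ .refl
  · obtain ⟨hr, -⟩ := WeightedGraph.scaledDist_spec hd
    rw [Nat.le_zero.mp h0] at hr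
    generalize d / n = a at hr
    cases hr with
    | nil => rw [startBound, if_pos rfl, ← hd, scaledDist_self]

/-- The nodes know the surroundings of the nodes nearby when the phases begin. -/
lemma wp_explorations {Q : (Fin n → Memory n M) → Prop} {l : List (Operation n M)}
    (hQ : ∀ m, Informed G s t (startBound s) m → Protocol.Wp (algorithm n M) G l Q m)
    {m : Fin n → Memory n M} (h : Ready G s m) :
    Protocol.Wp (algorithm n M) G (reset :: (((List.range t).flatMap fun _ => [explore]) ++
      copy :: (((List.range t).flatMap fun _ => [exploreViews]) ++ l))) Q m := by
  refine ⟨fun v => (h v).2, fair_silent _ _, ?_⟩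
  refine (Protocol.Wp.loop (I := fun r m => m = fun v =>
    { Memory.start M (G.nodeInput s v) with near := known G G.edges r v }) ?_
    fun r _ m hm => wp_explore r hm).append fun m₁ hm₁ => ?_
  · funext v
    simp only [Op.next, reset, silent, (h v).1, known_zero]
    rfl
  refine ⟨fun v => by rw [hm₁]; rfl, fair_silent _ _, ?_⟩
  refine (Protocol.Wp.loop (I := fun r m => m = fun v =>
    { Memory.start M (G.nodeInput s v) with
      near := G.ball t v, views := known G (G.ball t) r v }) ?_
    fun r _ m hm => wp_exploreViews r hm).append fun m₂ hm₂ => ?_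
  · funext v
    simp only [Op.next, copy, silent, known_zero, hm₁]
    rfl
  refine hQ m₂ ⟨fun v => ?_, fun v => ?_, fun v => ?_, fun v => ?_⟩
  · rw [hm₂]; rfl
  · rw [hm₂]
  · rw [hm₂]
    simp only [Memory.start, WeightedGraph.nodeInput, startBound]
    by_cases hv : v = s <;> simp [hv]
  · rw [hm₂]; rfl

/-! ### Verification of the bounds and the spreading of alarms. -/

/-- Whether the bounds of `v` and its neighbors are consistent. -/
def Consistent (G : WeightedGraph n) (x : Fin n → Option ℕ) (v : Fin n) : Prop :=
  ∀ z c b, G.edges v z = some c → x z = some b → ∃ a, x v = some a ∧ a ≤ b + (n * c + 1)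

/-- Consistency along a walk from `s` bounds `x` by its cost; soundness gives the reverse
inequality. -/
lemma eq_scaledDist_of_consistent (hsound : ∀ v a, x v = some a → HasCost G.edges s v a)
    (hs : x s = some 0) (h : ∀ v, Consistent G x v) (v : Fin n) : x v = scaledDist G.edges s v := by
  have hle : ∀ {v k c}, Reach G.edges s v k c → ∃ a, x v = some a ∧ a ≤ n * c + k := by
    intro v k c hr
    induction hr with
    | nil => exact ⟨0, hs, Nat.zero_le _⟩
    | @snoc v w k c e _ he ih =>
      obtain ⟨b, hb, hbl⟩ := ih
      obtain ⟨a, ha, hal⟩ := h w v e b (by rw [WeightedGraph.edges_symm, he]) hb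
      exact ⟨a, ha, by rw [Nat.mul_add]; omega⟩
  cases hd : scaledDist G.edges s v with
  | none =>
    by_contra hne
    obtain ⟨a, ha⟩ := Option.ne_none_iff_exists'.mp hne
    obtain ⟨d, hd', -⟩ := (hsound v a ha).scaledDist_le
    rw [hd] at hd'
    cases hd'
  | some d =>
    obtain ⟨k, c, hr, rfl⟩ := hasCost_of_scaledDist hd
    obtain ⟨a, ha, hal⟩ := hle hr
    rw [ha, le_antisymm hal (le_of_scaledDist hd (hsound v a ha))]

lemma consistent_scaledDist (v : Fin n) : Consistent G (scaledDist G.edges s) v := by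
  intro z c b hc hb
  rw [WeightedGraph.edges_symm] at hc
  exact ((hasCost_of_scaledDist hb).trans (HasCost.edge hc)).scaledDist_le

/-- Whether some of the `2 ^ k` nodes that end with `v`, in cyclic order, satisfies `P`. -/
def Window (P : Fin n → Prop) (k : ℕ) (v : Fin n) : Prop :=
  ∃ u, P u ∧ ∃ j < 2 ^ k, (u.val + j) % n = v.val

lemma window_zero {P : Fin n → Prop} {v : Fin n} : Window P 0 v ↔ P v := by
  constructor
  · rintro ⟨u, hu, j, hj, h⟩
    obtain rfl : j = 0 := by simpa using hj
    rw [Nat.add_zero, Nat.mod_eq_of_lt u.2] at h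
    exact Fin.ext h ▸ hu
  · intro h
    exact ⟨v, h, 0, by simp, by simp [Nat.mod_eq_of_lt v.2]⟩

lemma window_succ {P : Fin n → Prop} {k : ℕ} {v : Fin n} : Window P (k + 1) v ↔
    Window P k v ∨ ∃ w, Window P k w ∧ (w.val + 2 ^ k) % n = v.val := by
  constructor
  · rintro ⟨u, hu, j, hj, h⟩
    rcases lt_or_ge j (2 ^ k) with hlt | hge
    · exact Or.inl ⟨u, hu, j, hlt, h⟩
    · obtain ⟨i, rfl⟩ := Nat.exists_eq_add_of_le hge
      rw [pow_succ] at hj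
      refine Or.inr ⟨⟨(u.val + i) % n, Nat.mod_lt _ v.pos⟩, ⟨u, hu, i, by omega, rfl⟩, ?_⟩
      simp only [Nat.mod_add_mod]
      rw [← h]
      congr 1
      omega
  · rintro (⟨u, hu, j, hj, h⟩ | ⟨w, ⟨u, hu, j, hj, h⟩, hw⟩)
    · exact ⟨u, hu, j, by rw [pow_succ]; omega, h⟩
    · refine ⟨u, hu, j + 2 ^ k, by rw [pow_succ]; omega, ?_⟩
      rw [← hw, ← h, Nat.mod_add_mod, Nat.add_assoc]

/-- The window covers the whole cycle, so after the last alarm step all nodes decide alike. -/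
lemma window_of_le {P : Fin n → Prop} {k : ℕ} (hk : n ≤ 2 ^ k) {v : Fin n} :
    Window P k v ↔ ∃ u, P u := by
  constructor
  · rintro ⟨u, hu, -⟩
    exact ⟨u, hu⟩
  · rintro ⟨u, hu⟩
    refine ⟨u, hu, (v.val + (n - u.val)) % n, (Nat.mod_lt _ v.pos).trans_le hk, ?_⟩
    rw [Nat.add_mod_mod, show u.val + (v.val + (n - u.val)) = v.val + n by omega,
      Nat.add_mod_right, Nat.mod_eq_of_lt v.2]

lemma wp_spreadAlarm {P : Fin n → Prop} {k : ℕ} {m : Fin n → Memory n M}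
    (h : Informed G s t x m) (ha : ∀ v, (m v).alarm = true ↔ Window P k v) :
    Protocol.Wp (algorithm n M) G [spreadAlarm k]
      (fun m' => Informed G s t x m' ∧ ∀ v, (m' v).alarm = true ↔ Window P (k + 1) v) m := by
  have hsend : ∀ u v (i : WithTop (Item n M)), (spreadAlarm k).send (m u) = some (v, i) ↔
      Window P k u ∧ (u.val + 2 ^ k) % n = v.val ∧ ⊤ = i := by
    intro u v i
    simp only [spreadAlarm]
    have hid : (m u).input.id = u := by rw [h.input]; rfl
    by_cases hu : (m u).alarm = true
    · simp [hu, (ha u).mp hu, hid, Fin.ext_iff]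
    · simp [hu, mt (ha u).mpr hu]
  have hfair : (spreadAlarm k : Operation n M).Fair m := by
    intro u u' v i i' hu hu'
    have h1 := ((hsend u v i).mp hu).2.1
    have h2 := ((hsend u' v i').mp hu').2.1
    -- Cyclic shifts are injective, so no node is the target of two alarms.
    have h3 : u.val + 2 ^ k ≡ u'.val + 2 ^ k [MOD n] := h1.trans h2.symm
    have h4 := Nat.ModEq.add_right_cancel' _ h3
    rw [Nat.ModEq, Nat.mod_eq_of_lt u.2, Nat.mod_eq_of_lt u'.2] at h4
    exact Fin.ext h4
  refine .single h.output hfair ⟨⟨h.input, h.views, h.bound, h.output⟩, fun v => ?_⟩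
  rw [window_succ, ← ha]
  have : ((spreadAlarm k).next G m v).alarm =
      ((m v).alarm || ((spreadAlarm k).received m v).isSome) := rfl
  rw [this, Bool.or_eq_true]
  refine or_congr_right ?_
  constructor
  · intro hr
    obtain ⟨i, hi⟩ := Option.isSome_iff_exists.mp hr
    obtain ⟨u, hu⟩ := Op.received_eq_some hi
    obtain ⟨h1, h2, -⟩ := (hsend u v i).mp hu
    exact ⟨u, h1, h2⟩
  · rintro ⟨w, hw, hwv⟩
    rw [hfair.received_eq_some ((hsend w v ⊤).mpr ⟨hw, hwv, rfl⟩)]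
    rfl

/-- The verification: the nodes terminate if all bounds are consistent. -/
lemma wp_verification (hK : n ≤ 2 ^ K) {l : ℕ} {m : Fin n → Memory n M}
    (h : Informed G s t x m) (hx : Bounds M G s l x) :
    Protocol.Wp (algorithm n M) G
      (check :: (((List.range K).flatMap fun k => [spreadAlarm k]) ++ [finish]))
      (fun m' => (∀ v, (m' v).output = some (G.dist v s)) ∨ (l < G.spd ∧ Ready G s m')) m := by
  refine ⟨h.output, fair_silent _ _, ?_⟩
  refine (Protocol.Wp.loop (I := fun k m => Informed G s t x m ∧
      ∀ v, (m v).alarm = true ↔ Window (fun u => ¬ Consistent G x u) k v) ?_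
    fun k _ m hm => wp_spreadAlarm hm.1 hm.2).append fun m₁ hm₁ => ?_
  · refine ⟨⟨h.input, h.views, h.bound, h.output⟩, fun v => ?_⟩
    rw [window_zero]
    simp only [Op.next, check, silent, Bool.not_eq_true', decide_eq_false_iff_not, h.input, h.bound]
    refine not_congr ⟨fun hc z c b hcz hb => ?_, fun hc z m' c b hm' hcz hb => ?_⟩
    · exact hc z (m z) c b (neighbors_eq_some.mpr ⟨(WeightedGraph.edges_eq_some.mp hcz).1, rfl⟩) hcz
        (by rw [h.bound]; exact hb)
    · obtain ⟨-, rfl⟩ := neighbors_eq_some.mp hm'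
      exact hc z c b hcz (by rw [← h.bound]; exact hb)
  obtain ⟨h₁, ha⟩ := hm₁
  simp only [window_of_le hK] at ha
  refine .single h₁.output (fair_silent _ _) ?_
  have hout : ∀ v, (finish.next G m₁ v).output =
      if (m₁ v).alarm then none else some (m₁ v).result := fun v => rfl
  by_cases hcons : ∃ u, ¬ Consistent G x u
  · right
    refine ⟨?_, fun v => ⟨h₁.input v, by rw [hout, if_pos ((ha v).mpr hcons)]⟩⟩
    by_contra hspd
    obtain ⟨u, hu⟩ := hcons
    refine hu ?_
    -- Hop numbers are at most `spd ≤ l`, so all bounds would be exact and hence consistent.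
    have : x = scaledDist G.edges s := by
      funext v
      cases hd : scaledDist G.edges s v with
      | none =>
        by_contra hne
        obtain ⟨a, ha⟩ := Option.ne_none_iff_exists'.mp hne
        obtain ⟨d, hd', -⟩ := (hx.sound v a ha).scaledDist_le
        rw [hd] at hd'
        cases hd'
      | some d =>
        exact hx.exact v d hd ((WeightedGraph.scaledDist_spec hd).2.2.1.trans (not_lt.mp hspd))
    rw [this]
    exact consistent_scaledDist u
  · left
    intro v
    rw [hout, if_neg (mt (ha v).mp hcons), Memory.result, h₁.bound]
    have hs : x s = some 0 := hx.exact s 0 scaledDist_self (by simp)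
    rw [eq_scaledDist_of_consistent hx.sound hs (by simpa using hcons) v]
    cases hd : scaledDist G.edges s v with
    | none => rw [WeightedGraph.dist_eq_top_of_scaledDist hd]
    | some d => rw [(WeightedGraph.scaledDist_spec hd).2.1]

/-- A stage finds and verifies the distances if `t` is large enough. -/
theorem wp_stage (hK : n ≤ 2 ^ K) (hlog : Nat.log 2 n < K)
    (hM : ∀ v d, scaledDist G.edges s v = some d → d < M) {m : Fin n → Memory n M}
    (h : Ready G s m) :
    Protocol.Wp (algorithm n M) G (stage n M K t)
      (fun m' => (∀ v, (m' v).output = some (G.dist v s)) ∨ (t * t < G.spd ∧ Ready G s m')) m := by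
  refine wp_explorations (fun m₁ h₁ => ?_) h
  refine (Protocol.Wp.loop (I := fun i m => ∃ x, Informed G s t x m ∧ Bounds M G s (i * t) x)
    ⟨_, h₁, by rw [Nat.zero_mul]; exact bounds_startBound hM⟩ fun i _ m hm => ?_).append
    fun m₂ hm₂ => ?_
  · obtain ⟨x, h1, h2⟩ := hm
    rw [Nat.succ_mul]
    exact wp_phase hK hlog h1 h2
  · obtain ⟨x, h1, h2⟩ := hm₂
    exact wp_verification hK h1 h2

end Stages

/-! ### The number of rounds -/

section Rounds

variable {n M K : ℕ}

lemma length_flatMap_range {α : Type*} (f : ℕ → List α) (k c : ℕ) (h : ∀ i, (f i).length ≤ c) :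
    ((List.range k).flatMap f).length ≤ k * c := by
  induction k with
  | zero => simp
  | succ k ih =>
    rw [List.range_succ, List.flatMap_append, List.flatMap_singleton, List.length_append,
      Nat.succ_mul]
    exact Nat.add_le_add ih (h k)

lemma length_aggregate_le : (aggregate n M K).length ≤ K * K + 2 := by
  simpa [aggregate] using length_sortNet_le K

lemma length_treeRound_le : (treeRound n M K).length ≤ K * (K * K + 3) + 1 := by
  rw [treeRound, List.length_cons]
  exact Nat.add_le_add_right (length_flatMap_range _ _ _ fun k => by
    rw [jumpRound, List.length_cons]
    exact Nat.add_le_add_right length_aggregate_le 1) 1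

lemma length_phase_le (l : ℕ) : (phase n M K l).length ≤ K * (K * (K * K + 3) + 1) + 2 := by
  rw [phase, List.length_cons, List.length_append, List.length_singleton]
  exact Nat.add_le_add_right (Nat.add_le_add_right
    (length_flatMap_range _ _ _ fun _ => length_treeRound_le) 1) 1

/-- With `K ^ 4 * t` as unit, `15 = 7 + 2 + 1 + 5`: the phases, the two explorations, the alarms,
and four single operations plus the loading round. -/
lemma length_stage_le (hK : 1 ≤ K) {t : ℕ} (ht : 1 ≤ t) :
    (stage n M K t).length + 1 ≤ 15 * K ^ 4 * t := by
  have h1 := length_flatMap_range (fun _ => [(Operation.explore : Operation n M)]) t 1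
    fun _ => le_rfl
  have h2 := length_flatMap_range (fun _ => [(Operation.exploreViews : Operation n M)]) t 1
    fun _ => le_rfl
  have h3 := length_flatMap_range (fun i => phase n M K (i * t)) t _ fun i => length_phase_le _
  have h4 := length_flatMap_range (fun k => [(Operation.spreadAlarm k : Operation n M)]) K 1
    fun _ => le_rfl
  simp only [stage, List.length_cons, List.length_append, List.length_nil]
  have e1 : K ≤ K ^ 4 := Nat.le_self_pow (by norm_num) K
  have e2 : K ^ 2 ≤ K ^ 4 := Nat.pow_le_pow_right hK (by norm_num)
  have e3 : K * (K * (K * K + 3) + 1) + 2 ≤ 7 * K ^ 4 := by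
    have : K * (K * (K * K + 3) + 1) + 2 = K ^ 4 + 3 * K ^ 2 + K + 2 := by ring
    omega
  have e4 : t * (K * (K * (K * K + 3) + 1) + 2) ≤ t * (7 * K ^ 4) := Nat.mul_le_mul_left t e3
  have e5 : t * 1 ≤ t * K ^ 4 := Nat.mul_le_mul_left t (by omega)
  have e6 : 1 * K ^ 4 ≤ t * K ^ 4 := Nat.mul_le_mul_right _ ht
  have e7 : 15 * K ^ 4 * t = 15 * (t * K ^ 4) := by ring
  have e8 : t * (7 * K ^ 4) = 7 * (t * K ^ 4) := by ring
  omega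

/-- The stages with `t = 1, 2, …, 2 ^ J` form a geometric sum, at most twice the bound for the last
one. -/
lemma duration_algorithm_le (J : ℕ) :
    (algorithm n M).duration (J + 1) ≤ 30 * (Nat.log 2 n + 1) ^ 4 * 2 ^ J := by
  induction J with
  | zero =>
    have := length_stage_le (n := n) (M := M) (K := Nat.log 2 n + 1) (t := 2 ^ 0) (by omega) le_rfl
    simp only [Protocol.duration, algorithm]
    refine this.trans ?_
    gcongr
    norm_num
  | succ J ih =>
    have := length_stage_le (n := n) (M := M) (K := Nat.log 2 n + 1) (t := 2 ^ (J + 1)) (by omega)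
      Nat.one_le_two_pow
    rw [Protocol.duration, Finset.sum_range_succ]
    refine (Nat.add_le_add ih this).trans (le_of_eq ?_)
    ring

lemma exists_stage (D : ℕ) : ∃ J, D ≤ 2 ^ J * 2 ^ J ∧ (2 : ℝ) ^ J ≤ 2 * √(max (D : ℝ) 1) := by
  have hex : ∃ J, D ≤ 2 ^ J * 2 ^ J :=
    ⟨D, Nat.lt_two_pow_self.le.trans (Nat.le_mul_self _)⟩
  classical
  refine ⟨Nat.find hex, Nat.find_spec hex, ?_⟩
  have h1 : (1 : ℝ) ≤ √(max (D : ℝ) 1) := Real.one_le_sqrt.mpr (le_max_right _ _)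
  cases hJ : Nat.find hex with
  | zero => rw [pow_zero]; linarith
  | succ J =>
    -- The stage before the first sufficient one has `t * t < D`, so the last `t` is at most `2 *
    -- √D`.
    have hlt := Nat.find_min hex (m := J) (by omega)
    have h2 : ((2 : ℝ) ^ J) ≤ √(max (D : ℝ) 1) := by
      refine Real.le_sqrt_of_sq_le (le_max_of_le_left ?_)
      have : 2 ^ J * 2 ^ J ≤ D := by omega
      rw [sq]
      exact_mod_cast this
    rw [pow_succ]
    linarith

lemma log_succ_le (hn : 4 ≤ n) : ((Nat.log 2 n + 1 : ℕ) : ℝ) ≤ 3 * Real.log n := by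
  have h2 := Real.log_two_gt_d9
  have hpow : ((2 ^ Nat.log 2 n : ℕ) : ℝ) ≤ n := by
    exact_mod_cast Nat.pow_log_le_self 2 (by omega)
  have h3 : Nat.log 2 n * Real.log 2 ≤ Real.log n := by
    rw [← Real.log_pow]
    exact Real.log_le_log (by positivity) (by exact_mod_cast hpow)
  have h4 : 2 * Real.log 2 ≤ Real.log n := by
    have : (2 : ℝ) * Real.log 2 = Real.log 4 := by
      rw [show (4 : ℝ) = 2 ^ 2 by norm_num, Real.log_pow]; norm_num
    rw [this]
    exact Real.log_le_log (by norm_num) (by exact_mod_cast hn)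
  push_cast
  nlinarith [(Nat.cast_nonneg (Nat.log 2 n) : (0 : ℝ) ≤ _)]

/-- A target, a value below `n ^ (q + 3)` and a root, or `⊤`: at most `n ^ (q + 6)` messages. The
factor `2` in the exponent absorbs the rounding of the logarithm. -/
lemma card_message_le (q : ℕ) (hn : 4 ≤ n) :
    Fintype.card (WithTop (Item n (n ^ (q + 3)))) ≤ 2 ^ (2 * (q + 6) * Nat.log 2 n) := by
  have h1 : n ≤ 2 ^ (2 * Nat.log 2 n) := by
    refine (Nat.lt_pow_succ_log_self (b := 2) (by norm_num) n).le.trans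
      (Nat.pow_le_pow_right (by norm_num) ?_)
    have : 1 ≤ Nat.log 2 n := (Nat.le_log_iff_pow_le (by norm_num) (by omega)).mpr (by omega)
    omega
  have h2 : 1 ≤ n ^ (q + 5) := Nat.one_le_pow _ _ (by omega)
  rw [card_withTop_item]
  calc n * (n ^ (q + 3) * n) + 1 = n ^ (q + 5) + 1 := by ring
    _ ≤ n ^ (q + 5) * n := by nlinarith
    _ = n ^ (q + 6) := by ring
    _ ≤ (2 ^ (2 * Nat.log 2 n)) ^ (q + 6) := Nat.pow_le_pow_left h1 _
    _ = 2 ^ (2 * (q + 6) * Nat.log 2 n) := by rw [← pow_mul]; ring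

end Rounds

/-- The algorithm solves SSSP with certainty. -/
theorem algorithm_solvesWith {n q γ : ℕ} (hn : 4 ≤ n) (hγ : 1 ≤ γ) {G : WeightedGraph n}
    {s : Fin n} (hw : ∀ e ∈ G.graph.edgeSet, G.weight e ≤ n ^ q) {J T : ℕ}
    (hJ : G.spd ≤ 2 ^ J * 2 ^ J) (hT : (algorithm n (n ^ (q + 3))).duration (J + 1) ≤ T)
    (ω : Fin T → Fin n → Fin ((algorithm n (n ^ (q + 3))).toProgram γ
      (2 * (q + 6) * Nat.log 2 n)).coins) :
    ((algorithm n (n ^ (q + 3))).toProgram γ (2 * (q + 6) * Nat.log 2 n)).SolvesWith G s ω := by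
  refine Protocol.solvesWith hγ (card_message_le q hn) (P := Ready G s) (J := J)
    (fun m hm v => (hm v).2) (fun v => ⟨rfl, rfl⟩) (fun g m hm => ?_) hT
  refine (wp_stage (Nat.lt_pow_succ_log_self (by norm_num) n).le (Nat.lt_succ_self _)
    (fun v d hd => WeightedGraph.scaledDist_lt (by omega) hw hd) hm).mono fun m' hm' => ?_
  refine hm'.imp_right fun h => ⟨?_, h.2⟩
  rintro rfl
  exact absurd h.1 (not_lt.mpr hJ)

end Hybrid

theorem theorem2p7 :
    -- `k`: exponent of the polylogarithmic factor; `q`: weights are at most `n ^ q`;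
    -- `β`, `κ`: messages have `β log n` bits and the global capacity is `κ log n`;
    -- `c`: exponent of the failure probability.
    ∃ k : ℕ, ∀ q : ℕ, ∃ β : ℕ, ∀ κ : ℕ, 1 ≤ κ → ∀ c : ℝ, 0 < c →
      ∃ (C : ℝ) (n₀ : ℕ)
        (A : ∀ n : ℕ, Hybrid.Program n (κ * Nat.log 2 n) (β * Nat.log 2 n)),
        ∀ n : ℕ, n₀ ≤ n →
          ∀ (G : Hybrid.WeightedGraph n) (s : Fin n),
            (∀ e ∈ G.graph.edgeSet, G.weight e ≤ n ^ q) →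
              1 - 1 / (n : ℝ) ^ c ≤
                (A n).successProb G s
                  ⌊C * Real.sqrt (max (G.spd : ℝ) 1) * Real.log (n : ℝ) ^ k⌋₊ := by
  -- `4860 = 30 * 3 ^ 4 * 2`, from `duration_algorithm_le`, `log_succ_le` and `exists_stage`.
  refine ⟨4, fun q => ⟨2 * (q + 6), fun κ hκ c _ => ⟨4860, 4,
    fun n => (Hybrid.algorithm n (n ^ (q + 3))).toProgram _ _, fun n hn G s hw => ?_⟩⟩⟩
  have hlog : 1 ≤ Nat.log 2 n := (Nat.le_log_iff_pow_le (by norm_num) (by omega)).mpr (by omega)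
  have hγ : 1 ≤ κ * Nat.log 2 n := Nat.mul_pos hκ hlog
  obtain ⟨J, hJ, hJ'⟩ := Hybrid.exists_stage G.spd
  rw [Hybrid.Program.successProb_eq_one fun ω =>
    Hybrid.algorithm_solvesWith hn hγ hw hJ (Nat.le_floor ?_) ω]
  · have : 0 ≤ 1 / (n : ℝ) ^ c := by positivity
    linarith
  · refine (Nat.cast_le.mpr (Hybrid.duration_algorithm_le J)).trans ?_
    have h1 := pow_le_pow_left₀ (Nat.cast_nonneg _) (Hybrid.log_succ_le hn) 4
    have h2 : (0 : ℝ) ≤ Real.log n := Real.log_natCast_nonneg n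
    rw [Nat.cast_mul, Nat.cast_mul, Nat.cast_pow, Nat.cast_pow]
    calc ((30 : ℕ) : ℝ) * ((Nat.log 2 n + 1 : ℕ) : ℝ) ^ 4 * ((2 : ℕ) : ℝ) ^ J
        ≤ 30 * (3 * Real.log n) ^ 4 * (2 * √(max (G.spd : ℝ) 1)) := by
          push_cast at h1 ⊢
          gcongr
      _ = 4860 * √(max (G.spd : ℝ) 1) * Real.log n ^ 4 := by ring
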